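/- Let $G$ be a finite-dimensional real Lie group with Lie algebra $\mathfrak g$, identified with the left invariant vector fields on $G$, and let $g^1,g^2$ be left invariant Riemannian metrics on $G$. For a vector field $X$ on $G$ with flow $\varphi_t$, let $X^c$ (complete lift) and $X^v$ (vertical lift) be the vector fields on the tangent bundle $TG$ given by $$X^c(x,y)=\frac{d}{dt}\Big|_{t=0}T\varphi_t(x,y),\qquad X^v(x,y)=\frac{d}{dt}\Big|_{t=0}\big(x,\,y+tX(x)\big)\qquad(x\in G,\ y\in T_xG).$$ Let $\tilde g$ be the Riemannian metric on $TG$ determined by $$\tilde g(X^c,Y^c)=g^1(X,Y),\qquad \tilde g(X^v,Y^v)=g^2(X,Y),\qquad \tilde g(X^c,Y^v)=0\qquad (X,Y\in\mathfrak g).$$ A smooth vector field $X$ on a Riemannian manifold $(M,g)$ is called conformal if $\mathcal L_Xg=2\rho g$ for some $\rho\in C^\infty(M)$, and Killing if $\mathcal L_Xg=0$. Let $X\in\mathfrak g$. Then: (i) $X$ is conformal with respect to both $g^1$ and $g^2$ if and only if $X^c$ is conformal with respect to $\tilde g$. (ii) $X^v$ is a Killing field of $\tilde g$ if and only if $X\in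 Z(\mathfrak g)=\{Y\in\mathfrak g : [Z,Y]=0 \text{ for all } Z\in\mathfrak g\}$. -/

import Mathlib

open Bundle VectorField
open scoped Manifold ContDiff

namespace TangentLift

lemma tangentBundle_mk_eq {E : Type*} [NormedAddCommGroup E] [NormedSpace ℝ E] {H : Type*}
    [TopologicalSpace H] {I : ModelWithCorners ℝ E H} {M : Type*} [TopologicalSpace M]
    [ChartedSpace H M] {p q : M} (h : p = q) {u : TangentSpace I p} {w : TangentSpace I q}
    (hu : (u : E) = (w : E)) : (⟨p, u⟩ : TangentBundle I M) = ⟨q, w⟩ := by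
  subst h
  exact congrArg (fun z : TangentSpace I p ↦ (⟨p, z⟩ : TangentBundle I M)) hu

/-- Smooth Riemannian metrics on a manifold `M`. -/
abbrev SmoothMetric {E : Type*} [NormedAddCommGroup E] [NormedSpace ℝ E] {H : Type*}
    [TopologicalSpace H] (I : ModelWithCorners ℝ E H) (M : Type*) [TopologicalSpace M]
    [ChartedSpace H M] [IsManifold I ∞ M] :=
  ContMDiffRiemannianMetric I ∞ E (TangentSpace I : M → Type _)

section Manifold

variable {E : Type*} [NormedAddCommGroup E] [NormedSpace ℝ E] {H : Type*} [TopologicalSpace H]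
  {I : ModelWithCorners ℝ E H} {M : Type*} [TopologicalSpace M] [ChartedSpace H M]
  [IsManifold I ∞ M]

/-- A vector field is smooth if it is a `C^∞` section of the tangent bundle. -/
def IsSmoothField (X : Π x : M, TangentSpace I x) : Prop :=
  ContMDiff I I.tangent ∞ (fun x ↦ (⟨x, X x⟩ : TangentBundle I M))

/-- The Lie derivative of a Riemannian metric:
`(L_X g)(Y, Z) = X(g(Y, Z)) - g([X, Y], Z) - g(Y, [X, Z])`. -/
noncomputable def lieDerivMetric (g : SmoothMetric I M) (X Y Z : Π x : M, TangentSpace I x)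
    (x : M) : ℝ :=
  mvfderiv I (fun z ↦ g.inner z (Y z) (Z z)) x (X x)
    - g.inner x (mlieBracket I X Y x) (Z x) - g.inner x (Y x) (mlieBracket I X Z x)

/-- `X` is a conformal vector field: `L_X g = 2 ρ g` for some `ρ ∈ C^∞(M)`. -/
def IsConformalField (g : SmoothMetric I M) (X : Π x : M, TangentSpace I x) : Prop :=
  IsSmoothField X ∧ ∃ ρ : M → ℝ, ContMDiff I 𝓘(ℝ, ℝ) ∞ ρ ∧
    ∀ Y Z : Π x : M, TangentSpace I x, IsSmoothField Y → IsSmoothField Z →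
      ∀ x, lieDerivMetric g X Y Z x = 2 * ρ x * g.inner x (Y x) (Z x)

/-- `X` is a Killing vector field: `L_X g = 0`. -/
def IsKillingField (g : SmoothMetric I M) (X : Π x : M, TangentSpace I x) : Prop :=
  IsSmoothField X ∧
    ∀ Y Z : Π x : M, TangentSpace I x, IsSmoothField Y → IsSmoothField Z →
      ∀ x, lieDerivMetric g X Y Z x = 0

/-- The vertical lift `X^v` of a vector field `X` on `M`: at a point `p = (x, y)` of `TM`, it is the
velocity at `t = 0` of the curve `t ↦ (x, y + t X(x))`. -/
noncomputable def verticalLift (X : Π x : M, TangentSpace I x) (p : TangentBundle I M) :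
    TangentSpace I.tangent p :=
  mfderiv 𝓘(ℝ, ℝ) I.tangent (fun t : ℝ ↦ (⟨p.1, p.2 + t • X p.1⟩ : TangentBundle I M)) 0 (1 : ℝ)

/-- The complete lift `X^c` of a vector field `X` on `M`. At `p = (x, y)`, in the coordinates
`(xⁱ, yⁱ)` of `TM` induced by coordinates `xⁱ` of `M`, it is `Xⁱ ∂/∂xⁱ + yʲ (∂ⱼXⁱ) ∂/∂yⁱ`.
The tangent space of `TM` at `p` is identified in Mathlib with `E × E` through the chart of `TM`
induced by the preferred chart of `M` at `x`, and the `trivializationAt` term below is the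
coordinate expression of `X` in that same chart. Lemma `completeLift_eq_mfderiv_tangentMap` below
shows that `X^c` is the velocity of the curves `t ↦ Tφ_t(p)`, where `φ` is the flow of `X`. -/
noncomputable def completeLift (X : Π x : M, TangentSpace I x) (p : TangentBundle I M) :
    TangentSpace I.tangent p :=
  ((X p.1, mfderiv I 𝓘(ℝ, E)
    (fun x ↦ (trivializationAt E (TangentSpace I) p.1 ⟨x, X x⟩).2) p.1 p.2) : E × E)

section T
variable {E' : Type*} [NormedAddCommGroup E'] [NormedSpace ℝ E'] {H' : Type*} [TopologicalSpace H']
  {J : ModelWithCorners ℝ E' H'} {N : Type*} [TopologicalSpace N] [ChartedSpace H' N]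

/-- The derivative of a map into the tangent bundle, in components. -/
lemma mfderiv_tangentBundle_apply {f : N → TangentBundle I M} {a : N}
    (hf : MDifferentiableAt J I.tangent f a) (q : TangentBundle I M) (hq : f a = q)
    (v : TangentSpace J a) :
    (mfderiv J I.tangent f a v : E × E) =
      ((mfderiv J I (fun n ↦ (f n).1) a v : E),
        (mfderiv J 𝓘(ℝ, E) (fun n ↦ (trivializationAt E (TangentSpace I) q.1 (f n)).2) a v : E)) := by
  subst hq
  have h2 := (mdifferentiableAt_totalSpace I f).1 hf
  have e : writtenInExtChartAt J I.tangent a f = fun z ↦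
     (writtenInExtChartAt J I a (fun n ↦ (f n).1) z,
      writtenInExtChartAt J 𝓘(ℝ, E) a (fun n ↦ (trivializationAt E (TangentSpace I) (f a).1 (f n)).2) z) := by
    funext z
    simp only [writtenInExtChartAt, FiberBundle.extChartAt, ModelWithCorners.tangent]
    rfl
  have hu : UniqueDiffWithinAt ℝ (Set.range J) (extChartAt J a a) :=
    J.uniqueDiffOn _ (Set.mem_range_self _)
  have k1 := h2.1.differentiableWithinAt_writtenInExtChartAt
  have k2 := h2.2.differentiableWithinAt_writtenInExtChartAt
  have key := DifferentiableWithinAt.fderivWithin_prodMk k1 k2 hu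
  have m0 : (mfderiv J I.tangent f a : E' →L[ℝ] E × E) = _ := hf.mfderiv
  have m1 : (mfderiv J I (fun n ↦ (f n).1) a : E' →L[ℝ] E) = _ := h2.1.mfderiv
  have m2 : (mfderiv J 𝓘(ℝ, E) (fun n ↦ (trivializationAt E (TangentSpace I) (f a).1 (f n)).2) a :
    E' →L[ℝ] E) = _ := h2.2.mfderiv
  have m : (mfderiv J I.tangent f a : E' →L[ℝ] E × E) =
      ContinuousLinearMap.prod (mfderiv J I (fun n ↦ (f n).1) a : E' →L[ℝ] E)
      (mfderiv J 𝓘(ℝ, E) (fun n ↦ (trivializationAt E (TangentSpace I) (f a).1 (f n)).2) a :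
        E' →L[ℝ] E) := by
    rw [m0, m1, m2, e]; exact key
  exact congrArg (fun L : E' →L[ℝ] E × E ↦ L v) m
end T

lemma trivializationAt_self_snd (x : M) (v : TangentSpace I x) :
    (trivializationAt E (TangentSpace I) x (⟨x, v⟩ : TangentBundle I M)).2 = v :=
  (tangentBundleCore I M).coordChange_self (achart H x) x (mem_chart_source H x) v

lemma trivializationAt_snd {x₀ x : M} (hx : x ∈ (chartAt H x₀).source) (v : TangentSpace I x) :
    (trivializationAt E (TangentSpace I) x₀ (⟨x, v⟩ : TangentBundle I M)).2 =
      mfderiv I 𝓘(ℝ, E) (extChartAt I x₀) x v := by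
  have h1 : (trivializationAt E (TangentSpace I) x₀).continuousLinearMapAt ℝ x v =
      (trivializationAt E (TangentSpace I) x₀ (⟨x, v⟩ : TangentBundle I M)).2 := by
    rw [Trivialization.continuousLinearMapAt_apply, Trivialization.linearMapAt_apply, if_pos]
    exact hx
  exact h1.symm.trans (congrArg (fun L : E →L[ℝ] E ↦ L v)
    (TangentBundle.continuousLinearMapAt_trivializationAt hx))

lemma verticalLift_eq (X : Π x : M, TangentSpace I x) (p : TangentBundle I M) :
    verticalLift X p = ((0, X p.1) : E × E) := by
  have aux (a b : E) : HasFDerivAt (fun t : ℝ ↦ a + t • b)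
      ((ContinuousLinearMap.id ℝ ℝ).smulRight b) 0 :=
    ((ContinuousLinearMap.id ℝ ℝ).smulRight b).hasFDerivAt.const_add _
  have hd := aux p.2 (X p.1)
  have hs : (fun t : ℝ ↦ (trivializationAt E (TangentSpace I) p.1
      (⟨p.1, p.2 + t • X p.1⟩ : TangentBundle I M)).2) = fun t ↦ p.2 + t • X p.1 :=
    funext fun t ↦ trivializationAt_self_snd p.1 _
  have hf : MDifferentiableAt 𝓘(ℝ, ℝ) I.tangent
      (fun t : ℝ ↦ (⟨p.1, p.2 + t • X p.1⟩ : TangentBundle I M)) 0 := by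
    refine (mdifferentiableAt_totalSpace I _).2 ⟨mdifferentiableAt_const, ?_⟩
    exact hs ▸ hd.differentiableAt.mdifferentiableAt
  have h := mfderiv_tangentBundle_apply hf ⟨p.1, p.2 + (0 : ℝ) • X p.1⟩ rfl (1 : ℝ)
  refine h.trans (Prod.ext ?_ ?_)
  · have := mfderiv_const (I := 𝓘(ℝ, ℝ)) (I' := I) (c := p.1) (x := (0 : ℝ))
    exact congrArg (fun L : ℝ →L[ℝ] E ↦ L 1) this
  · have h1 : mfderiv 𝓘(ℝ, ℝ) 𝓘(ℝ, E) (fun t : ℝ ↦ (trivializationAt E (TangentSpace I) p.1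
      (⟨p.1, p.2 + t • X p.1⟩ : TangentBundle I M)).2) 0 =
        (fderiv ℝ (fun t : ℝ ↦ (trivializationAt E (TangentSpace I) p.1
      (⟨p.1, p.2 + t • X p.1⟩ : TangentBundle I M)).2) 0 : ℝ →L[ℝ] E) := mfderiv_eq_fderiv
    refine (congrArg (fun L : ℝ →L[ℝ] E ↦ L 1) h1).trans ?_
    have h2 : fderiv ℝ (fun t : ℝ ↦ (trivializationAt E (TangentSpace I) p.1
      (⟨p.1, p.2 + t • X p.1⟩ : TangentBundle I M)).2) 0 = _ := (hs ▸ hd.fderiv)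
    rw [h2]
    exact one_smul ℝ (X p.1 : E)

/-- If `φ_0 = id` and `X` is the velocity field of `φ_t` at `t = 0` (for instance if `φ` is the flow
of `X`), then the complete lift of `X` at `p` is the velocity of the curve `t ↦ Tφ_t(p)`. -/
lemma completeLift_eq_mfderiv_tangentMap [I.Boundaryless] (φ : ℝ × M → M) (p : TangentBundle I M)
    (hφ : ContMDiffAt (𝓘(ℝ, ℝ).prod I) I 2 φ (0, p.1)) (h0 : ∀ x, φ (0, x) = x)
    (X : Π x : M, TangentSpace I x)
    (hX : ∀ x, X x = (mfderiv 𝓘(ℝ, ℝ) I (fun t : ℝ ↦ φ (t, x)) 0 (1 : ℝ) : E)) :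
    completeLift X p =
      (mfderiv 𝓘(ℝ, ℝ) I.tangent (fun t : ℝ ↦ tangentMap I I (fun x ↦ φ (t, x)) p) 0 (1 : ℝ) :
        E × E) := by
  obtain ⟨x, y⟩ := p
  dsimp only at hφ
  set e := extChartAt I x with he
  set z₀ : E := e x with hz₀
  let ψ : ℝ × E → E := fun q ↦ e (φ (q.1, e.symm q.2))
  have ez : e.symm z₀ = x := extChartAt_to_inv x
  have hsymm : ContMDiffAt 𝓘(ℝ, E) I 2 e.symm z₀ := by
    have := contMDiffOn_extChartAt_symm (I := I) (n := 2) x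
    exact this.contMDiffAt (extChartAt_target_mem_nhds x)
  have hin : ContMDiffAt 𝓘(ℝ, ℝ × E) (𝓘(ℝ, ℝ).prod I) 2
      (fun q : ℝ × E ↦ (q.1, e.symm q.2)) (0, z₀) := by
    refine ContMDiffAt.prodMk contDiff_fst.contMDiff.contMDiffAt ?_
    exact ContMDiffAt.comp (0, z₀) hsymm contDiff_snd.contMDiff.contMDiffAt
  have hext : ContMDiffAt I 𝓘(ℝ, E) 2 e x := contMDiffAt_extChartAt
  have hψ : ContDiffAt ℝ 2 ψ (0, z₀) := by
    refine ContMDiffAt.contDiffAt ?_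
    refine ContMDiffAt.comp_of_eq (y := x) hext
      (ContMDiffAt.comp_of_eq (y := ((0 : ℝ), x)) hφ hin ?_) ?_
    · simp [ez]
    · simp [ez, h0]
  let D := fderiv ℝ ψ
  have hD : DifferentiableAt ℝ D (0, z₀) :=
    (hψ.fderiv_right (m := 1) (by norm_num)).differentiableAt (by simp)
  have hsym := hψ.isSymmSndFDerivAt (by simp)
  have hψd : ∀ᶠ q in nhds ((0 : ℝ), z₀), DifferentiableAt ℝ ψ q := by
    filter_upwards [hψ.eventually (by simp)] with q hq using hq.differentiableAt (by simp)
  have hφd : ∀ᶠ q in nhds ((0 : ℝ), x), MDifferentiableAt (𝓘(ℝ, ℝ).prod I) I φ q := by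
    filter_upwards [(contMDiffAt_iff_contMDiffAt_nhds (by simp)).1 hφ] with q hq using hq.mdifferentiableAt (by simp)
  have hφs : ∀ᶠ q in nhds ((0 : ℝ), x), φ q ∈ (chartAt H x).source := by
    refine hφ.continuousAt.eventually_mem ?_
    rw [h0]
    exact chart_source_mem_nhds H x
  have ht0 : Filter.Tendsto (fun t : ℝ ↦ (t, x)) (nhds 0) (nhds (0, x)) :=
    Continuous.tendsto' (by fun_prop) _ _ rfl
  have ht1 : Filter.Tendsto (fun t : ℝ ↦ (t, z₀)) (nhds 0) (nhds (0, z₀)) :=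
    Continuous.tendsto' (by fun_prop) _ _ rfl
  have hx0 : Filter.Tendsto (fun x' : M ↦ ((0 : ℝ), x')) (nhds x) (nhds (0, x)) :=
    Continuous.tendsto' (by fun_prop) _ _ rfl
  have hx1 : Filter.Tendsto (fun x' : M ↦ ((0 : ℝ), e x')) (nhds x) (nhds (0, z₀)) :=
    (continuousAt_const.prodMk (continuousAt_extChartAt x))
  -- the lifted curve, read in the chart
  have A : ∀ᶠ t in nhds (0 : ℝ), (trivializationAt E (TangentSpace I) x
      (tangentMap I I (fun x ↦ φ (t, x)) ⟨x, y⟩)).2 = D (t, z₀) (0, y) := by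
    filter_upwards [ht0.eventually hφd, ht0.eventually hφs, ht1.eventually hψd] with t h1 h2 h3
    have k1 : MDifferentiableAt I I (fun x ↦ φ (t, x)) x :=
      MDifferentiableAt.comp x h1 (mdifferentiableAt_const.prodMk mdifferentiableAt_id)
    have k2 : HasMFDerivAt I 𝓘(ℝ, E) (e ∘ fun x ↦ φ (t, x)) x _ :=
      (mdifferentiableAt_extChartAt h2).hasMFDerivAt.comp x k1.hasMFDerivAt
    have k3 : HasFDerivAt (fun z : E ↦ ψ (t, z)) ((D (t, z₀)).comp (.inr ℝ ℝ E)) (e x) :=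
      h3.hasFDerivAt.comp (e x) (hasFDerivAt_prodMk_right t z₀)
    have k4 : HasMFDerivAt I 𝓘(ℝ, E) ((fun z : E ↦ ψ (t, z)) ∘ e) x _ :=
      k3.hasMFDerivAt.comp x (mdifferentiableAt_extChartAt (mem_chart_source H x)).hasMFDerivAt
    have k5 : (e ∘ fun x ↦ φ (t, x)) =ᶠ[nhds x] (fun z : E ↦ ψ (t, z)) ∘ e := by
      filter_upwards [extChartAt_source_mem_nhds (I := I) x] with x' hx'
      simp only [Function.comp_apply, ψ, he, (extChartAt I x).left_inv hx']
    have k6 := hasMFDerivAt_unique k2 (k4.congr_of_eventuallyEq k5)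
    refine (trivializationAt_snd h2 _).trans ?_
    refine (congrArg (fun L : E →L[ℝ] E ↦ L y) k6).trans ?_
    have k7 : (mfderiv I 𝓘(ℝ, E) e x : E →L[ℝ] E) = ContinuousLinearMap.id ℝ E :=
      mfderiv_extChartAt_self
    change D (t, z₀) (0, (mfderiv I 𝓘(ℝ, E) e x : E →L[ℝ] E) y) = _
    rw [k7]
    rfl
  have B : ∀ᶠ x' in nhds x, (trivializationAt E (TangentSpace I) x
      (⟨x', X x'⟩ : TangentBundle I M)).2 = D (0, e x') (1, 0) := by
    filter_upwards [hx0.eventually hφd, hx1.eventually hψd, chart_source_mem_nhds H x]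
      with x' h1 h3 h2
    have k1 : MDifferentiableAt 𝓘(ℝ, ℝ) I (fun t : ℝ ↦ φ (t, x')) 0 :=
      MDifferentiableAt.comp (0 : ℝ) h1 (mdifferentiableAt_id.prodMk mdifferentiableAt_const)
    have h2' : φ (0, x') ∈ (chartAt H x).source := by rwa [h0]
    have k2 : HasMFDerivAt 𝓘(ℝ, ℝ) 𝓘(ℝ, E) (e ∘ fun t : ℝ ↦ φ (t, x')) 0 _ :=
      (mdifferentiableAt_extChartAt h2').hasMFDerivAt.comp 0 k1.hasMFDerivAt
    have k3 : HasFDerivAt (fun t : ℝ ↦ ψ (t, e x')) ((D (0, e x')).comp (.inl ℝ ℝ E)) 0 :=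
      HasFDerivAt.comp (g := ψ) (f := fun t : ℝ ↦ (t, e x')) (0 : ℝ) h3.hasFDerivAt (hasFDerivAt_prodMk_left (𝕜 := ℝ) (0 : ℝ) (e x'))
    have k5 : (e ∘ fun t : ℝ ↦ φ (t, x')) = (fun t : ℝ ↦ ψ (t, e x')) := by
      funext t
      have hx' : x' ∈ (extChartAt I x).source := by rwa [extChartAt_source]
      simp only [Function.comp_apply, ψ, he, (extChartAt I x).left_inv hx']
    rw [k5] at k2
    have k6 := hasMFDerivAt_unique k2 k3.hasMFDerivAt
    refine (trivializationAt_snd h2 _).trans ?_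
    have k8 : (mfderiv I 𝓘(ℝ, E) e x' : E →L[ℝ] E) = mfderiv I 𝓘(ℝ, E) e (φ (0, x')) :=
      congrArg (fun q : M ↦ (show E →L[ℝ] E from mfderiv I 𝓘(ℝ, E) e q)) (h0 x').symm
    refine (congrArg (fun L : E →L[ℝ] E ↦ L (X x')) k8).trans ?_
    rw [hX]
    exact congrArg (fun L : ℝ →L[ℝ] E ↦ L 1) k6
  -- the derivatives of both sides are second derivatives of `ψ`
  have hA : HasFDerivAt (fun t : ℝ ↦ D (t, z₀) (0, y)) (((ContinuousLinearMap.apply ℝ E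
      ((0, y) : ℝ × E)).comp (fderiv ℝ D (0, z₀))).comp (.inl ℝ ℝ E)) 0 :=
    HasFDerivAt.comp (g := fun q ↦ D q (0, y)) (f := fun t : ℝ ↦ (t, z₀)) (0 : ℝ)
      ((ContinuousLinearMap.apply ℝ E ((0, y) : ℝ × E)).hasFDerivAt.comp _ hD.hasFDerivAt)
      (hasFDerivAt_prodMk_left (𝕜 := ℝ) (0 : ℝ) z₀)
  have hB : HasFDerivAt (fun z : E ↦ D (0, z) (1, 0)) (((ContinuousLinearMap.apply ℝ E
      ((1, 0) : ℝ × E)).comp (fderiv ℝ D (0, z₀))).comp (.inr ℝ ℝ E)) (e x) :=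
    ((ContinuousLinearMap.apply ℝ E ((1, 0) : ℝ × E)).hasFDerivAt.comp _ hD.hasFDerivAt).comp
      (e x) (hasFDerivAt_prodMk_right (0 : ℝ) z₀)
  have hB' : HasMFDerivAt I 𝓘(ℝ, E) ((fun z : E ↦ D (0, z) (1, 0)) ∘ e) x _ :=
    hB.hasMFDerivAt.comp x (mdifferentiableAt_extChartAt (mem_chart_source H x)).hasMFDerivAt
  have hB'' := (hB'.congr_of_eventuallyEq B).mfderiv
  have hA' := (hA.hasMFDerivAt.congr_of_eventuallyEq A)
  have hid : (fun x ↦ φ (0, x)) = id := funext h0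
  have hq : tangentMap I I (fun x ↦ φ (0, x)) ⟨x, y⟩ = (⟨x, y⟩ : TangentBundle I M) := by
    rw [hid, tangentMap_id]; rfl
  have hc : MDifferentiableAt 𝓘(ℝ, ℝ) I.tangent
      (fun t : ℝ ↦ tangentMap I I (fun x ↦ φ (t, x)) ⟨x, y⟩) 0 := by
    refine (mdifferentiableAt_totalSpace I _).2 ⟨?_, ?_⟩
    · exact MDifferentiableAt.comp (g := φ) (f := fun t : ℝ ↦ (t, x)) (0 : ℝ) (hφ.mdifferentiableAt (by simp))
        (mdifferentiableAt_id.prodMk mdifferentiableAt_const)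
    · rw [hq]
      exact hA'.mdifferentiableAt
  refine Eq.trans ?_ (mfderiv_tangentBundle_apply hc _ hq (1 : ℝ)).symm
  refine Prod.ext (hX x) ?_
  refine (congrArg (fun L : E →L[ℝ] E ↦ L y) hB'').trans ?_
  refine Eq.trans ?_ (congrArg (fun L : ℝ →L[ℝ] E ↦ L 1) hA'.mfderiv).symm
  have k7 : (mfderiv I 𝓘(ℝ, E) e x : E →L[ℝ] E) = ContinuousLinearMap.id ℝ E :=
    mfderiv_extChartAt_self
  change fderiv ℝ D (0, z₀) (0, (mfderiv I 𝓘(ℝ, E) e x : E →L[ℝ] E) y) (1, 0) =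
    fderiv ℝ D (0, z₀) (1, 0) (0, y)
  rw [k7]
  exact hsym _ _

lemma exists_curve [I.Boundaryless] (x : M) (w : E) :
    ∃ c : ℝ → M, ContMDiffAt 𝓘(ℝ, ℝ) I ∞ c 0 ∧ c 0 = x ∧
      (mfderiv 𝓘(ℝ, ℝ) I c 0 (1 : ℝ) : E) = w := by
  set e := extChartAt I x with he
  have c0 : e.symm (e x + (0 : ℝ) • w) = x := by simp [he]
  have hl : HasFDerivAt (fun t : ℝ ↦ e x + t • w)
      ((ContinuousLinearMap.id ℝ ℝ).smulRight w) 0 :=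
    ((ContinuousLinearMap.id ℝ ℝ).smulRight w).hasFDerivAt.const_add _
  have ht : e.target ∈ nhds (e x + (0 : ℝ) • w) := by
    rw [zero_smul, add_zero]
    exact extChartAt_target_mem_nhds (I := I) x
  have hc : ContMDiffAt 𝓘(ℝ, ℝ) I ∞ (fun t : ℝ ↦ e.symm (e x + t • w)) 0 := by
    refine ContMDiffAt.comp (g := e.symm) (f := fun t : ℝ ↦ e x + t • w) (0 : ℝ)
      ((contMDiffOn_extChartAt_symm (I := I) (n := ∞) x).contMDiffAt ht) ?_
    have : ContDiff ℝ ∞ (fun t : ℝ ↦ e x + t • w) := by fun_prop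
    exact this.contMDiff 0
  refine ⟨fun t : ℝ ↦ e.symm (e x + t • w), hc, c0, ?_⟩
  have hs : e.symm (e x + (0 : ℝ) • w) ∈ (chartAt H x).source := by
    rw [c0]; exact mem_chart_source H x
  have h1 := (mdifferentiableAt_extChartAt (I := I) hs).hasMFDerivAt.comp (0 : ℝ)
    (hc.mdifferentiableAt (by simp)).hasMFDerivAt
  have h2 : (e ∘ fun t : ℝ ↦ e.symm (e x + t • w)) =ᶠ[nhds 0] fun t : ℝ ↦ e x + t • w := by
    filter_upwards [hl.continuousAt.eventually_mem ht] with t ht'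
    exact e.right_inv ht'
  have h3 := hasMFDerivAt_unique h1 (hl.hasMFDerivAt.congr_of_eventuallyEq h2)
  have h4 : (mfderiv I 𝓘(ℝ, E) e (e.symm (e x + (0 : ℝ) • w)) : E →L[ℝ] E) =
      ContinuousLinearMap.id ℝ E :=
    (congrArg (fun q : M ↦ (show E →L[ℝ] E from mfderiv I 𝓘(ℝ, E) e q)) c0).trans
      mfderiv_extChartAt_self
  have h5 := congrArg (fun L : ℝ →L[ℝ] E ↦ L 1) h3
  refine Eq.trans ?_ (h5.trans (one_smul ℝ w))
  exact (congrArg (fun L : E →L[ℝ] E ↦ L (mfderiv 𝓘(ℝ, ℝ) I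
    (fun t : ℝ ↦ e.symm (e x + t • w)) 0 (1 : ℝ))) h4).symm

section S
variable {E₁ : Type*} [NormedAddCommGroup E₁] [NormedSpace ℝ E₁] {H₁ : Type*} [TopologicalSpace H₁]
  {I₁ : ModelWithCorners ℝ E₁ H₁} {N : Type*} [TopologicalSpace N] [ChartedSpace H₁ N]
  {E₂ : Type*} [NormedAddCommGroup E₂] [NormedSpace ℝ E₂] {H₂ : Type*} [TopologicalSpace H₂]
  {I₂ : ModelWithCorners ℝ E₂ H₂} {P : Type*} [TopologicalSpace P] [ChartedSpace H₂ P]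

lemma mfderiv_apply_eq_of_curve {c : ℝ → N} (hc : ContMDiffAt 𝓘(ℝ, ℝ) I₁ ∞ c 0) {x : N}
    (c0 : c 0 = x) {f : N → P} (hf : ContMDiff I₁ I₂ ∞ f) :
    (mfderiv I₁ I₂ f x (mfderiv 𝓘(ℝ, ℝ) I₁ c 0 (1 : ℝ)) : E₂) =
      (mfderiv 𝓘(ℝ, ℝ) I₂ (fun t ↦ f (c t)) 0 (1 : ℝ) : E₂) := by
  have h1 := (hf.mdifferentiableAt (x := c 0) (by simp)).hasMFDerivAt.comp (0 : ℝ)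
    (hc.mdifferentiableAt (by simp)).hasMFDerivAt
  subst c0
  exact (congrArg (fun L : ℝ →L[ℝ] E₂ ↦ L 1) h1.mfderiv).symm

lemma contMDiff_mfderiv_right [IsManifold I₁ ∞ N] [IsManifold I₂ ∞ P] {A : N × P → M} (hA : ContMDiff (I₁.prod I₂) I ∞ A) (b : P)
    (v : TangentSpace I₂ b) :
    ContMDiff I₁ I.tangent ∞
      (fun n ↦ (⟨A (n, b), mfderiv I₂ I (fun z ↦ A (n, z)) b v⟩ : TangentBundle I M)) := by
  have s1 : ContMDiff I₁ (I₁.tangent.prod I₂.tangent) ∞ (fun n ↦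
      ((⟨n, 0⟩ : TangentBundle I₁ N), (⟨b, v⟩ : TangentBundle I₂ P))) :=
    (contMDiff_zeroSection ℝ (TangentSpace I₁ : N → Type _)).prodMk contMDiff_const
  have s2 := (hA.contMDiff_tangentMap (m := ∞) (by simp)).comp
    ((contMDiff_equivTangentBundleProd_symm (n := ∞) (I := I₁) (I' := I₂) (M := N) (M' := P)).comp s1)
  refine s2.congr fun n ↦ ?_
  refine tangentBundle_mk_eq (I := I) (M := M) rfl ?_
  have := mfderiv_prod_eq_add_apply (p := (n, b)) (v := ((0, v) : E₁ × E₂))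
    (hA.mdifferentiableAt (x := (n, b)) (by simp))
  refine Eq.trans ?_ this.symm
  have h0 : mfderiv I₁ I (fun z ↦ A (z, b)) n (0 : E₁) = (0 : E) := map_zero _
  change _ = (mfderiv I₁ I (fun z ↦ A (z, b)) n (0 : E₁) : E) + _
  rw [h0]
  exact (zero_add (mfderiv I₂ I (fun z ↦ A (n, z)) b v : E)).symm

end S

lemma contMDiff_verticalLift {X : Π x : M, TangentSpace I x}
    (hX : ContMDiff I I.tangent ∞ (fun x ↦ (⟨x, X x⟩ : TangentBundle I M))) :
    ContMDiff I.tangent I.tangent.tangent ∞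
      (fun p ↦ (⟨p, verticalLift X p⟩ : TangentBundle I.tangent (TangentBundle I M))) := by
  have hF : ContMDiff (I.tangent.prod 𝓘(ℝ, ℝ)) I.tangent ∞
      (fun q : TangentBundle I M × ℝ ↦
        (⟨q.1.1, q.1.2 + q.2 • X q.1.1⟩ : TangentBundle I M)) := by
    intro q₀
    have hp : ContMDiffAt (I.tangent.prod 𝓘(ℝ, ℝ)) I ∞
      (fun q : TangentBundle I M × ℝ ↦ q.1.1) q₀ :=
      (contMDiff_proj (TangentSpace I)).contMDiffAt.comp q₀ contMDiffAt_fst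
    refine contMDiffAt_totalSpace.2 ⟨hp, ?_⟩
    have h1 := (contMDiffAt_totalSpace.1
      (contMDiffAt_fst : ContMDiffAt (I.tangent.prod 𝓘(ℝ, ℝ)) I.tangent ∞ Prod.fst q₀)).2
    have h2 := (contMDiffAt_totalSpace.1 ((hX.contMDiffAt (x := q₀.1.1)).comp q₀ hp)).2
    have h3 : ContMDiffAt (I.tangent.prod 𝓘(ℝ, ℝ)) 𝓘(ℝ, ℝ) ∞
      (Prod.snd : TangentBundle I M × ℝ → ℝ) q₀ := contMDiffAt_snd
    refine (h1.add (h3.smul h2)).congr_of_eventuallyEq ?_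
    have hm : ∀ᶠ q in nhds q₀, q.1.1 ∈ (trivializationAt E (TangentSpace I) q₀.1.1).baseSet :=
      hp.continuousAt.eventually_mem (((trivializationAt E (TangentSpace I)
        q₀.1.1).open_baseSet).mem_nhds (mem_baseSet_trivializationAt E _ _))
    filter_upwards [hm] with q hq
    have hl := (trivializationAt E (TangentSpace I) q₀.1.1).linear ℝ hq
    exact (hl.map_add _ _).trans (congrArg₂ _ rfl (hl.map_smul _ _))
  refine (contMDiff_mfderiv_right hF (0 : ℝ) (1 : ℝ)).congr fun p ↦ ?_
  refine tangentBundle_mk_eq (I := I.tangent) (M := TangentBundle I M) ?_ rfl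
  refine tangentBundle_mk_eq (I := I) (M := M) rfl ?_
  change (p.2 : E) = p.2 + (0 : ℝ) • (X p.1 : E)
  simp
end Manifold

/-- The bilinear form `(A, B) ↦ b₁(S₁ A, S₁ B) + b₂(S₂ A, S₂ B)`, where `S = (S₁, S₂)`. -/
noncomputable def sumForm {E F : Type*} [NormedAddCommGroup E] [NormedSpace ℝ E]
    [NormedAddCommGroup F] [NormedSpace ℝ F] (b₁ b₂ : E →L[ℝ] E →L[ℝ] ℝ) (S : F →L[ℝ] E × E) :
    F →L[ℝ] F →L[ℝ] ℝ :=
  b₁.bilinearComp ((ContinuousLinearMap.fst ℝ E E).comp S)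
      ((ContinuousLinearMap.fst ℝ E E).comp S) +
    b₂.bilinearComp ((ContinuousLinearMap.snd ℝ E E).comp S)
      ((ContinuousLinearMap.snd ℝ E E).comp S)

lemma contDiff_sumForm {E F : Type*} [NormedAddCommGroup E] [NormedSpace ℝ E]
    [NormedAddCommGroup F] [NormedSpace ℝ F] [FiniteDimensional ℝ F] (b₁ b₂ : E →L[ℝ] E →L[ℝ] ℝ) :
    ContDiff ℝ ∞ (fun S : F →L[ℝ] E × E ↦ sumForm b₁ b₂ S) := by
  refine contDiff_clm_apply_iff.2 fun u ↦ contDiff_clm_apply_iff.2 fun w ↦ ?_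
  change ContDiff ℝ ∞ (fun S : F →L[ℝ] E × E ↦
    b₁ (S u).1 (S w).1 + b₂ (S u).2 (S w).2)
  fun_prop

lemma contMDiffAt_clm {E : Type*} [NormedAddCommGroup E] [NormedSpace ℝ E] {H : Type*}
    [TopologicalSpace H] {I : ModelWithCorners ℝ E H} {M : Type*} [TopologicalSpace M]
    [ChartedSpace H M] {F F' : Type*} [NormedAddCommGroup F] [NormedSpace ℝ F]
    [FiniteDimensional ℝ F] [NormedAddCommGroup F'] [NormedSpace ℝ F'] {f : M → F →L[ℝ] F'} {x : M}
    (h : ∀ u, ContMDiffAt I 𝓘(ℝ, F') ∞ (fun y ↦ f y u) x) :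
    ContMDiffAt I 𝓘(ℝ, F →L[ℝ] F') ∞ f x := by
  let d := Module.finrank ℝ F
  have hd : d = Module.finrank ℝ (Fin d → ℝ) := (Module.finrank_fin_fun ℝ).symm
  let e₁ := ContinuousLinearEquiv.ofFinrankEq hd
  let e₂ := (e₁.arrowCongr (1 : F' ≃L[ℝ] F')).trans (ContinuousLinearEquiv.piRing (Fin d))
  have : ContMDiffAt I 𝓘(ℝ, Fin d → F') ∞ (e₂ ∘ f) x := contMDiffAt_pi_space.2 fun i ↦ h _
  have h2 := (e₂.symm.contDiff (n := ∞)).contMDiff.contMDiffAt.comp x this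
  rwa [← Function.comp_assoc, e₂.symm_comp_self, Function.id_comp] at h2

section Group
variable {E : Type*} [NormedAddCommGroup E] [NormedSpace ℝ E] {H : Type*} [TopologicalSpace H]
  {I : ModelWithCorners ℝ E H} {G : Type*} [TopologicalSpace G] [ChartedSpace H G]
  [Group G] [LieGroup I ∞ G]

instance instLieGroupMinSmoothness : LieGroup I (minSmoothness ℝ 3) G := by
  rw [minSmoothness_of_isRCLikeNormedField]
  infer_instance

/-- A Riemannian metric on a Lie group is left invariant if all left translations preserve it. -/
def IsLeftInvariantMetric (g : SmoothMetric I G) : Prop :=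
  ∀ (a x : G) (u v : TangentSpace I x),
    g.inner (a * x) (mfderiv I I (fun y ↦ a * y) x u) (mfderiv I I (fun y ↦ a * y) x v) =
      g.inner x u v

lemma contMDiff_leftInvariant (v : GroupLieAlgebra I G) :
    ContMDiff I I.tangent ∞
      (fun x ↦ (⟨x, mulInvariantVectorField v x⟩ : TangentBundle I G)) := by
  refine (contMDiff_mfderiv_right (contMDiff_mul I ∞ (G := G)) 1 v).congr fun x ↦ ?_
  exact tangentBundle_mk_eq (I := I) (M := G) (mul_one x).symm rfl

lemma contMDiff_tangentMap_mul_right :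
    ContMDiff (I.tangent.prod I) I.tangent ∞
      (fun q : TangentBundle I G × G ↦ tangentMap I I (fun x ↦ x * q.2) q.1) := by
  have s1 : ContMDiff (I.tangent.prod I) (I.tangent.prod I.tangent) ∞
      (fun q : TangentBundle I G × G ↦ (q.1, (⟨q.2, 0⟩ : TangentBundle I G))) :=
    contMDiff_fst.prodMk
      ((contMDiff_zeroSection ℝ (TangentSpace I : G → Type _)).comp contMDiff_snd)
  have hm := contMDiff_mul I ∞ (G := G)
  have s2 := (hm.contMDiff_tangentMap (m := ∞) (by simp)).comp
    ((contMDiff_equivTangentBundleProd_symm (n := ∞) (I := I) (I' := I) (M := G) (M' := G)).comp s1)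
  refine s2.congr fun q ↦ ?_
  refine tangentBundle_mk_eq (I := I) (M := G) rfl ?_
  have := mfderiv_prod_eq_add_apply (p := (q.1.1, q.2)) (v := ((q.1.2, 0) : E × E))
    (hm.mdifferentiableAt (x := (q.1.1, q.2)) (by simp))
  refine Eq.trans ?_ this.symm
  have h0 : mfderiv I I (fun z ↦ q.1.1 * z) q.2 (0 : E) = (0 : E) := map_zero _
  change (mfderiv I I (fun z ↦ z * q.2) q.1.1 q.1.2 : E) =
    (mfderiv I I (fun z ↦ z * q.2) q.1.1 q.1.2 : E) +
      (mfderiv I I (fun z ↦ q.1.1 * z) q.2 (0 : E) : E)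
  rw [h0]
  exact (add_zero (mfderiv I I (fun z ↦ z * q.2) q.1.1 q.1.2 : E)).symm

lemma completeLift_leftInvariant [I.Boundaryless] (v : GroupLieAlgebra I G)
    (p : TangentBundle I G) :
    completeLift (mulInvariantVectorField v) p =
      (mfderiv I I.tangent (fun h ↦ tangentMap I I (fun x ↦ x * h) p) 1 v : E × E) := by
  obtain ⟨c, hc, c0, hcd⟩ := exists_curve (I := I) (1 : G) v
  have hφ : ContMDiffAt (𝓘(ℝ, ℝ).prod I) I ∞ (fun q : ℝ × G ↦ q.2 * c q.1) (0, p.1) :=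
    ContMDiffAt.mul contMDiffAt_snd (ContMDiffAt.comp (0, p.1) hc contMDiffAt_fst)
  have h1 (x : G) : mulInvariantVectorField v x =
      (mfderiv 𝓘(ℝ, ℝ) I (fun t : ℝ ↦ x * c t) 0 (1 : ℝ) : E) :=
    (congrArg (show E →L[ℝ] E from mfderiv I I (fun h ↦ x * h) 1) hcd.symm).trans
      (mfderiv_apply_eq_of_curve hc c0 contMDiff_mul_left)
  rw [completeLift_eq_mfderiv_tangentMap (fun q : ℝ × G ↦ q.2 * c q.1) p
    (hφ.of_le ENat.LEInfty.out)
    (fun x ↦ by simp [c0]) (mulInvariantVectorField v) h1]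
  have hΘ : ContMDiff I I.tangent ∞ (fun h : G ↦ tangentMap I I (fun x ↦ x * h) p) :=
    contMDiff_tangentMap_mul_right.comp (contMDiff_const.prodMk contMDiff_id)
  exact ((congrArg (show E →L[ℝ] E × E from
    mfderiv I I.tangent (fun h : G ↦ tangentMap I I (fun x ↦ x * h) p) 1) hcd.symm).trans
      (mfderiv_apply_eq_of_curve hc c0 hΘ)).symm

lemma contMDiff_completeLift [I.Boundaryless] (v : GroupLieAlgebra I G) :
    ContMDiff I.tangent I.tangent.tangent ∞
      (fun p ↦ (⟨p, completeLift (mulInvariantVectorField v) p⟩ :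
        TangentBundle I.tangent (TangentBundle I G))) := by
  refine (contMDiff_mfderiv_right contMDiff_tangentMap_mul_right 1 v).congr fun p ↦ ?_
  refine tangentBundle_mk_eq (I := I.tangent) (M := TangentBundle I G) ?_
    (completeLift_leftInvariant v p)
  simp only [mul_one]
  exact (congrFun (tangentMap_id (I := I) (M := G)) p).symm

lemma mulInvariantVectorField_injective (x : G) :
    Function.Injective (fun v : GroupLieAlgebra I G ↦ mulInvariantVectorField v x) := by
  have h1 : MDifferentiableAt I I (fun h : G ↦ x * h) 1 :=
    contMDiff_mul_left.mdifferentiableAt (n := ∞) (by simp)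
  have h2 : MDifferentiableAt I I (fun h : G ↦ x⁻¹ * h) (x * 1) :=
    contMDiff_mul_left.mdifferentiableAt (n := ∞) (by simp)
  have h3 := h2.hasMFDerivAt.comp (1 : G) h1.hasMFDerivAt
  have h4 : ((fun h : G ↦ x⁻¹ * h) ∘ fun h : G ↦ x * h) = id := by ext h; simp
  rw [h4] at h3
  have h5 := hasMFDerivAt_unique h3 (hasMFDerivAt_id (1 : G))
  have h6 : Function.LeftInverse (show E →L[ℝ] E from mfderiv I I (fun h : G ↦ x⁻¹ * h) (x * 1))
      (show E →L[ℝ] E from mfderiv I I (fun h : G ↦ x * h) 1) :=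
    fun v ↦ congrArg (fun L : E →L[ℝ] E ↦ L v) h5
  exact h6.injective

section Metric

variable [I.Boundaryless]

/-- The linear map `𝔤 ⊕ 𝔤 → T_p(TG)`, `(X, Y) ↦ X^c(p) + Y^v(p)`. -/
noncomputable def liftMap (p : TangentBundle I G) :
    (GroupLieAlgebra I G × GroupLieAlgebra I G) →ₗ[ℝ] TangentSpace I.tangent p where
  toFun a := completeLift (mulInvariantVectorField a.1) p +
    verticalLift (mulInvariantVectorField a.2) p
  map_add' a b := by
    have h (v w : GroupLieAlgebra I G) : completeLift (mulInvariantVectorField (v + w)) p =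
        completeLift (mulInvariantVectorField v) p + completeLift (mulInvariantVectorField w) p := by
      rw [completeLift_leftInvariant, completeLift_leftInvariant, completeLift_leftInvariant]
      exact map_add _ _ _
    have h' (v w : GroupLieAlgebra I G) : verticalLift (mulInvariantVectorField (v + w)) p =
        verticalLift (mulInvariantVectorField v) p + verticalLift (mulInvariantVectorField w) p := by
      rw [verticalLift_eq, verticalLift_eq, verticalLift_eq, mulInvariantVectorField_add]
      exact Prod.ext (add_zero (0 : E)).symm rfl
    rw [Prod.fst_add, Prod.snd_add, h, h']
    exact add_add_add_comm _ _ _ _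
  map_smul' r a := by
    have h (v : GroupLieAlgebra I G) : completeLift (mulInvariantVectorField (r • v)) p =
        r • completeLift (mulInvariantVectorField v) p := by
      rw [completeLift_leftInvariant, completeLift_leftInvariant]
      exact map_smul _ _ _
    have h' (v : GroupLieAlgebra I G) : verticalLift (mulInvariantVectorField (r • v)) p =
        r • verticalLift (mulInvariantVectorField v) p := by
      rw [verticalLift_eq, verticalLift_eq, mulInvariantVectorField_smul]
      exact Prod.ext (smul_zero (A := E) r).symm rfl
    rw [Prod.smul_fst, Prod.smul_snd, h, h']
    exact (smul_add _ _ _).symm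

lemma liftMap_injective (p : TangentBundle I G) : Function.Injective (liftMap p) := by
  refine (injective_iff_map_eq_zero (liftMap p)).2 fun a ha ↦ ?_
  have h : (completeLift (mulInvariantVectorField a.1) p : E × E) +
      (verticalLift (mulInvariantVectorField a.2) p : E × E) = 0 := ha
  have h1 : a.1 = 0 := by
    refine mulInvariantVectorField_injective p.1 ?_
    have := congrArg Prod.fst h
    rw [verticalLift_eq] at this
    have h2 : mulInvariantVectorField a.1 p.1 = 0 := (add_zero _).symm.trans this
    refine h2.trans (map_zero (mfderiv I I (fun h : G ↦ p.1 * h) 1)).symm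
  have h0 : completeLift (mulInvariantVectorField (0 : GroupLieAlgebra I G)) p = 0 := by
    rw [completeLift_leftInvariant]; exact map_zero _
  have h3 : a.2 = 0 := by
    refine mulInvariantVectorField_injective p.1 ?_
    rw [h1, h0, verticalLift_eq] at h
    have h2 : mulInvariantVectorField a.2 p.1 = 0 := (zero_add _).symm.trans (congrArg Prod.snd h)
    refine h2.trans (map_zero (mfderiv I I (fun h : G ↦ p.1 * h) 1)).symm
  exact Prod.ext h1 h3

variable [FiniteDimensional ℝ E]

/-- At each point `p` of `TG`, the map `(X, Y) ↦ X^c(p) + Y^v(p)` is an isomorphism from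
`𝔤 ⊕ 𝔤` to the tangent space of `TG`. -/
noncomputable def liftEquiv (p : TangentBundle I G) :
    (GroupLieAlgebra I G × GroupLieAlgebra I G) ≃L[ℝ] TangentSpace I.tangent p :=
  letI L : (E × E) →ₗ[ℝ] (E × E) := liftMap p
  have hL : Function.Injective L := liftMap_injective p
  (LinearEquiv.ofBijective L ⟨hL, LinearMap.injective_iff_surjective.1 hL⟩).toContinuousLinearEquiv

lemma liftEquiv_apply (p : TangentBundle I G) (v w : GroupLieAlgebra I G) :
    liftEquiv p (v, w) = completeLift (mulInvariantVectorField v) p +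
      verticalLift (mulInvariantVectorField w) p := rfl

end Metric

section Metric

variable [I.Boundaryless] [FiniteDimensional ℝ E]

/-- The bilinear form on `T_p(TG)` for which `g̃(X^c, Y^c) = g₁(X, Y)`, `g̃(X^v, Y^v) = g₂(X, Y)` and
`g̃(X^c, Y^v) = 0` for all left invariant `X`, `Y`. -/
noncomputable def liftedInner (g₁ g₂ : SmoothMetric I G) (p : TangentBundle I G) :
    TangentSpace I.tangent p →L[ℝ] TangentSpace I.tangent p →L[ℝ] ℝ :=
  sumForm (E := E) (F := E × E) (g₁.inner 1) (g₂.inner 1) (liftEquiv p).symm.toContinuousLinearMap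

lemma liftedInner_apply (g₁ g₂ : SmoothMetric I G) (p : TangentBundle I G)
    (A B : TangentSpace I.tangent p) :
    liftedInner g₁ g₂ p A B =
      g₁.inner 1 ((liftEquiv p).symm A).1 ((liftEquiv p).symm B).1 +
      g₂.inner 1 ((liftEquiv p).symm A).2 ((liftEquiv p).symm B).2 := rfl

lemma contMDiff_liftedInner (g₁ g₂ : SmoothMetric I G) :
    ContMDiff I.tangent (I.tangent.prod 𝓘(ℝ, E × E →L[ℝ] E × E →L[ℝ] ℝ)) ∞
      (fun p : TangentBundle I G ↦ TotalSpace.mk' (E × E →L[ℝ] E × E →L[ℝ] ℝ) p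
        (liftedInner g₁ g₂ p)) := by
  intro p₀
  have : CompleteSpace E := FiniteDimensional.complete ℝ E
  refine (contMDiffAt_hom_bundle _).2 ⟨contMDiffAt_id, ?_⟩
  let e := trivializationAt (E × E) (TangentSpace I.tangent : TangentBundle I G → Type _) p₀
  have he : p₀ ∈ e.baseSet := mem_baseSet_trivializationAt _ _ _
  -- the frame of lifts, read in the trivialization
  let K : TangentBundle I G → (E × E →L[ℝ] E × E) := fun p ↦
    (e.continuousLinearMapAt ℝ p).comp (liftEquiv p).toContinuousLinearMap
  have hK1 (p) (u : E × E) : K p u = e.continuousLinearMapAt ℝ p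
    (completeLift (mulInvariantVectorField (show GroupLieAlgebra I G from u.1)) p +
      verticalLift (mulInvariantVectorField (show GroupLieAlgebra I G from u.2)) p) := rfl
  have hK : ContMDiffAt I.tangent 𝓘(ℝ, E × E →L[ℝ] E × E) ∞ K p₀ := by
    refine contMDiffAt_clm fun u ↦ ?_
    have h1 := (contMDiffAt_totalSpace.1 ((contMDiff_completeLift (I := I) (G := G) u.1) p₀)).2
    have h2 := (contMDiffAt_totalSpace.1
      ((contMDiff_verticalLift (contMDiff_leftInvariant (I := I) (G := G) u.2)) p₀)).2
    refine (h1.add h2).congr_of_eventuallyEq ?_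
    filter_upwards [e.open_baseSet.mem_nhds he] with p hp
    have hl := e.coe_linearMapAt_of_mem (R := ℝ) hp
    refine (hK1 p u).trans ((map_add (e.continuousLinearMapAt ℝ p) _ _).trans ?_)
    exact congrArg₂ _ (congrFun hl _) (congrFun hl _)
  let Q (p) (hp : p ∈ e.baseSet) : (E × E) ≃L[ℝ] (E × E) :=
    (liftEquiv p).trans (e.continuousLinearEquivAt ℝ p hp)
  have hKinv (p) (hp : p ∈ e.baseSet) : K p = Q p hp := by
    refine ContinuousLinearMap.ext fun u ↦ ?_
    exact congrArg (fun f : TangentSpace I.tangent p → E × E ↦ f (liftEquiv p u))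
      (e.coe_continuousLinearEquivAt_eq hp).symm
  have hR : ContMDiffAt I.tangent 𝓘(ℝ, E × E →L[ℝ] E × E) ∞ (fun p ↦ (K p).inverse) p₀ := by
    have : (K p₀).IsInvertible := ⟨_, (hKinv p₀ he).symm⟩
    exact ContMDiffAt.comp (g := ContinuousLinearMap.inverse) p₀
      (this.contDiffAt_map_inverse (n := ∞)).contMDiffAt hK
  have hS := ((contDiff_sumForm (E := E) (F := E × E) (g₁.inner (1 : G))
    (g₂.inner (1 : G))).contMDiff.contMDiffAt).comp p₀ hR
  refine hS.congr_of_eventuallyEq ?_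
  filter_upwards [e.open_baseSet.mem_nhds he] with p hp
  refine ContinuousLinearMap.ext fun u ↦ ContinuousLinearMap.ext fun w ↦ ?_
  have h := inCoordinates_apply_eq₂ (F₁ := E × E) (F₂ := E × E) (F₃ := ℝ)
    (E₁ := (TangentSpace I.tangent : TangentBundle I G → Type _))
    (E₂ := (TangentSpace I.tangent : TangentBundle I G → Type _)) (E₃ := Bundle.Trivial (TangentBundle I G) ℝ)
    (ϕ := liftedInner g₁ g₂ p) (v := u) (w := w) hp hp (x₀ := p₀) (by simp)
  have ht : (trivializationAt ℝ (Bundle.Trivial (TangentBundle I G) ℝ) p₀).linearMapAt ℝ p =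
      LinearMap.id := Bundle.Trivial.linearMapAt_trivialization ℝ _ _ p
  refine h.trans ((congrArg (fun L : ℝ →ₗ[ℝ] ℝ ↦ L _) ht).trans ?_)
  have hi : (K p).inverse = (Q p hp).symm := by
    rw [hKinv p hp, ContinuousLinearMap.inverse_equiv]
  change _ = sumForm _ _ (K p).inverse u w
  rw [hi]
  rfl


lemma isVonNBounded_liftedInner (g₁ g₂ : SmoothMetric I G) (p : TangentBundle I G) :
    Bornology.IsVonNBounded ℝ {A : TangentSpace I.tangent p | liftedInner g₁ g₂ p A A < 1} := by
  have hpos (g : SmoothMetric I G) (v : GroupLieAlgebra I G) : 0 ≤ g.inner 1 v v := by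
    rcases eq_or_ne v 0 with rfl | hv
    · simp
    · exact (g.pos 1 v hv).le
  let V (g : SmoothMetric I G) : Set E := {v | g.inner 1 v v < 1}
  have hV (g : SmoothMetric I G) : Bornology.IsBounded (V g) :=
    NormedSpace.isVonNBounded_iff ℝ |>.1 (g.isVonNBounded 1)
  have hb : Bornology.IsVonNBounded ℝ ((V g₁) ×ˢ (V g₂)) :=
    NormedSpace.isVonNBounded_iff ℝ |>.2 ((hV g₁).prod (hV g₂))
  have hi := hb.image (liftEquiv p).toContinuousLinearMap
  have hsub : {A : TangentSpace I.tangent p | liftedInner g₁ g₂ p A A < 1} ⊆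
      (liftEquiv p).toContinuousLinearMap '' ((V g₁) ×ˢ (V g₂)) := by
    intro A hA
    refine (Set.mem_image _ _ _).2
      ⟨(liftEquiv p).symm A, Set.mem_prod.2 ⟨?_, ?_⟩, (liftEquiv p).apply_symm_apply A⟩
    · have := hpos g₂ ((liftEquiv p).symm A).2
      have h2 : liftedInner g₁ g₂ p A A < 1 := hA
      rw [liftedInner_apply] at h2
      exact lt_of_le_of_lt (le_add_of_nonneg_right this) h2
    · have := hpos g₁ ((liftEquiv p).symm A).1
      have h2 : liftedInner g₁ g₂ p A A < 1 := hA
      rw [liftedInner_apply] at h2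
      exact lt_of_le_of_lt (le_add_of_nonneg_left this) h2
  exact hi.subset hsub

/-- The lifted Riemannian metric `g̃` on `TG` defined by two left invariant metrics `g₁`, `g₂` on
`G`, characterized by the three lemmas below. A left invariant field is determined by its value in
`𝔤 = T_1 G`, and `g_i(X, Y)` is the constant function with value `g_i(X(1), Y(1))`. -/
noncomputable def liftedMetric (g₁ g₂ : SmoothMetric I G) :
    SmoothMetric I.tangent (TangentBundle I G) where
  inner := liftedInner g₁ g₂
  symm p A B := by
    rw [liftedInner_apply, liftedInner_apply, g₁.symm, g₂.symm]
  pos p A hA := by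
    have hpos (g : SmoothMetric I G) (v : GroupLieAlgebra I G) : 0 ≤ g.inner 1 v v := by
      rcases eq_or_ne v 0 with rfl | hv
      · simp
      · exact (g.pos 1 v hv).le
    rw [liftedInner_apply]
    have hS : (liftEquiv p).symm A ≠ 0 := by simpa using hA
    by_cases h1 : ((liftEquiv p).symm A).1 = 0
    · have h2 : ((liftEquiv p).symm A).2 ≠ 0 := fun h2 ↦ hS (Prod.ext h1 h2)
      exact add_pos_of_nonneg_of_pos (hpos _ _) (g₂.pos 1 _ h2)
    · exact add_pos_of_pos_of_nonneg (g₁.pos 1 _ h1) (hpos _ _)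
  isVonNBounded := isVonNBounded_liftedInner g₁ g₂
  contMDiff := contMDiff_liftedInner g₁ g₂

lemma liftEquiv_symm_completeLift (v : GroupLieAlgebra I G) (p : TangentBundle I G) :
    (liftEquiv p).symm (completeLift (mulInvariantVectorField v) p) = (v, 0) := by
  rw [ContinuousLinearEquiv.symm_apply_eq, liftEquiv_apply, verticalLift_eq]
  have h0 : mulInvariantVectorField (0 : GroupLieAlgebra I G) p.1 = 0 :=
    map_zero (mfderiv I I (fun h : G ↦ p.1 * h) 1)
  rw [h0]
  exact (add_zero _).symm

lemma liftEquiv_symm_verticalLift (v : GroupLieAlgebra I G) (p : TangentBundle I G) :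
    (liftEquiv p).symm (verticalLift (mulInvariantVectorField v) p) = (0, v) := by
  rw [ContinuousLinearEquiv.symm_apply_eq, liftEquiv_apply]
  have h0 : completeLift (mulInvariantVectorField (0 : GroupLieAlgebra I G)) p = 0 := by
    rw [completeLift_leftInvariant]; exact map_zero _
  rw [h0]
  exact (zero_add _).symm

lemma liftedMetric_complete_complete (g₁ g₂ : SmoothMetric I G) (v w : GroupLieAlgebra I G)
    (p : TangentBundle I G) :
    (liftedMetric g₁ g₂).inner p (completeLift (mulInvariantVectorField v) p)
      (completeLift (mulInvariantVectorField w) p) = g₁.inner 1 v w := by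
  refine (liftedInner_apply g₁ g₂ p _ _).trans ?_
  rw [liftEquiv_symm_completeLift, liftEquiv_symm_completeLift]
  simp

lemma liftedMetric_vertical_vertical (g₁ g₂ : SmoothMetric I G) (v w : GroupLieAlgebra I G)
    (p : TangentBundle I G) :
    (liftedMetric g₁ g₂).inner p (verticalLift (mulInvariantVectorField v) p)
      (verticalLift (mulInvariantVectorField w) p) = g₂.inner 1 v w := by
  refine (liftedInner_apply g₁ g₂ p _ _).trans ?_
  rw [liftEquiv_symm_verticalLift, liftEquiv_symm_verticalLift]
  simp

lemma liftedMetric_complete_vertical (g₁ g₂ : SmoothMetric I G) (v w : GroupLieAlgebra I G)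
    (p : TangentBundle I G) :
    (liftedMetric g₁ g₂).inner p (completeLift (mulInvariantVectorField v) p)
      (verticalLift (mulInvariantVectorField w) p) = 0 := by
  refine (liftedInner_apply g₁ g₂ p _ _).trans ?_
  rw [liftEquiv_symm_completeLift, liftEquiv_symm_verticalLift]
  simp

end Metric

end Group

end TangentLift

/-!
Both claims are read off the Lie derivative of `g̃` on the frame of `TG` formed by the lifts `Y^c`,
`Y^v` of left invariant fields. The metric coefficients `g̃(Y^c, Z^c)`, `g̃(Y^v, Z^v)`, `g̃(Y^c, Z^v)`
are constant, so that `(L_V g̃)(A, B) = -g̃([V, A], B) - g̃(A, [V, B])` on the frame, and the brackets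
are `[X^c, Y^c] = [X, Y]^c`, `[X^c, Y^v] = [X, Y]^v` and `[X^v, Y^v] = 0`. Since `L_V g̃` is a tensor
(`exists_lieDerivMetric_eq`), its values on the frame determine it.

For `V = X^v` the only nonzero values are `-g₂([X, Y], Z)` on mixed pairs; they vanish for all `Y`
and `Z` exactly if `X` is central. For `V = X^c` one finds the values of `L_X g₁` on complete lifts,
those of `L_X g₂` on vertical lifts, and `0` on mixed pairs. The two conformal factors of `g₁` and
`g₂` match because they are both zero: `[X, X] = 0` forces a conformal left invariant field to be
Killing (`adForm_eq_zero_of_eq_mul`), and the same argument applies to `X^c`.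

The bracket formulas hold on every manifold without boundary modelled on a Banach space. A
tangent vector of `TM` is determined by its action on the functions `f ∘ π` and `df`, where `f` is a chart, and there the lifts act by
`X^c(df) = d(Xf)` and `X^v(df) = Xf`. The former (`differential_completeLift`) is the symmetry of
the second derivative of `f`. These rules give the components of the lifts in a fixed chart of `TM`
(`localRep_completeLift`, `localRep_verticalLift`), and then the brackets, as the bracket in a chart
has components `V(Wⁱ) - W(Vⁱ)` (`localRep_mlieBracket`).
-/

namespace TangentLift

/-! ### Vector fields and their brackets in charts -/

section Coordinates

variable {E : Type*} [NormedAddCommGroup E] [NormedSpace ℝ E] {H : Type*} [TopologicalSpace H]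
  {I : ModelWithCorners ℝ E H} {M : Type*} [TopologicalSpace M] [ChartedSpace H M]
  {F : Type*} [NormedAddCommGroup F] [NormedSpace ℝ F]

variable (I) in
/-- The differential of a vector-valued function at `x`, as a linear map on the model space `E`,
with which Mathlib identifies the tangent space at `x`. -/
noncomputable def differential (f : M → F) (x : M) : E →L[ℝ] F :=
  mfderiv I 𝓘(ℝ, F) f x

lemma differential_congr {f f' : M → F} {x : M} (h : f =ᶠ[nhds x] f') :
    differential I f x = differential I f' x :=
  h.mfderiv_eq

lemma differential_prodMk {F' : Type*} [NormedAddCommGroup F'] [NormedSpace ℝ F'] {f : M → F}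
    {f' : M → F'} {x : M} (hf : MDifferentiableAt I 𝓘(ℝ, F) f x)
    (hf' : MDifferentiableAt I 𝓘(ℝ, F') f' x) :
    differential I (fun y ↦ (f y, f' y)) x = (differential I f x).prod (differential I f' x) :=
  HasMFDerivAt.mfderiv (f := fun y ↦ (f y, f' y))
    ⟨hf.continuousAt.prodMk hf'.continuousAt, hf.hasMFDerivAt.2.prodMk hf'.hasMFDerivAt.2⟩

lemma differential_comp {F' : Type*} [NormedAddCommGroup F'] [NormedSpace ℝ F']
    {g : F → F'} {f : M → F} {x : M} (hg : DifferentiableAt ℝ g (f x))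
    (hf : MDifferentiableAt I 𝓘(ℝ, F) f x) :
    differential I (g ∘ f) x = (fderiv ℝ g (f x)).comp (differential I f x) :=
  (hg.hasFDerivAt.hasMFDerivAt.comp x hf.hasMFDerivAt).mfderiv

lemma differential_clm_apply {F' : Type*} [NormedAddCommGroup F'] [NormedSpace ℝ F']
    {c : M → F' →L[ℝ] F} {v : M → F'} {x : M}
    (hc : MDifferentiableAt I 𝓘(ℝ, F' →L[ℝ] F) c x) (hv : MDifferentiableAt I 𝓘(ℝ, F') v x) (u : E) :
    differential I (fun y ↦ c y (v y)) x u =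
      differential I c x u (v x) + c x (differential I v x u) := by
  have h1 : DifferentiableAt ℝ (fun q : (F' →L[ℝ] F) × F' ↦ q.1 q.2) (c x, v x) := by fun_prop
  have h2 := differential_comp (I := I) (x := x) (F := (F' →L[ℝ] F) × F')
    (g := fun q : (F' →L[ℝ] F) × F' ↦ q.1 q.2) (f := fun y ↦ (c y, v y)) h1 (hc.prodMk_space hv)
  refine (congrArg (fun L : E →L[ℝ] F ↦ L u) h2).trans ?_
  rw [differential_prodMk hc hv, fderiv_clm_apply (by fun_prop) (by fun_prop)]
  rw [add_comm]
  simp [fderiv_fst, fderiv_snd]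

variable [IsManifold I ∞ M]

/-- The components of the vector field `X` in the preferred chart at `x₀`. -/
noncomputable def localRep (x₀ : M) (X : Π x : M, TangentSpace I x) (x : M) : E :=
  (trivializationAt E (TangentSpace I) x₀ (⟨x, X x⟩ : TangentBundle I M)).2

lemma localRep_eq {x₀ x : M} (hx : x ∈ (chartAt H x₀).source) (X : Π x : M, TangentSpace I x) :
    localRep x₀ X x = differential I (extChartAt I x₀) x (X x) :=
  trivializationAt_snd hx _

lemma localRep_self (x : M) (X : Π x : M, TangentSpace I x) : localRep x X x = X x :=
  trivializationAt_self_snd x _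

lemma IsSmoothField.mdifferentiableAt {X : Π x : M, TangentSpace I x} (hX : IsSmoothField X)
    (x : M) : MDifferentiableAt I I.tangent (fun x ↦ (⟨x, X x⟩ : TangentBundle I M)) x :=
  ContMDiff.mdifferentiableAt hX (by simp)

lemma IsSmoothField.contMDiffAt_localRep {X : Π x : M, TangentSpace I x} (hX : IsSmoothField X)
    {x₀ x : M} (hx : x ∈ (chartAt H x₀).source) :
    ContMDiffAt I 𝓘(ℝ, E) ∞ (localRep x₀ X) x :=
  ((trivializationAt E (TangentSpace I) x₀).contMDiffAt_section_iff (n := ∞) (IB := I) hx).1 (hX x)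

lemma mdifferentiableAt_localRep {X : Π x : M, TangentSpace I x} {x₀ x : M}
    (hX : MDifferentiableAt I I.tangent (fun x ↦ (⟨x, X x⟩ : TangentBundle I M)) x)
    (hx : x ∈ (chartAt H x₀).source) :
    MDifferentiableAt I 𝓘(ℝ, E) (localRep x₀ X) x :=
  ((trivializationAt E (TangentSpace I) x₀).mdifferentiableAt_section_iff I _ hx).1 hX

variable [I.Boundaryless]

lemma mdifferentiableAt_extChartAt_symm_of_mem {x₀ : M} {z : E}
    (hz : z ∈ (extChartAt I x₀).target) :
    MDifferentiableAt 𝓘(ℝ, E) I (extChartAt I x₀).symm z := by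
  have := mdifferentiableWithinAt_extChartAt_symm (I := I) hz
  rwa [I.range_eq_univ, mdifferentiableWithinAt_univ] at this

/-- A differential computed in the chart at `x₀`. -/
lemma differential_eq_fderiv {x₀ x : M} (hx : x ∈ (chartAt H x₀).source) {f : M → F}
    (hf : MDifferentiableAt I 𝓘(ℝ, F) f x) :
    DifferentiableAt ℝ (f ∘ (extChartAt I x₀).symm) (extChartAt I x₀ x) ∧
      differential I f x = (fderiv ℝ (f ∘ (extChartAt I x₀).symm) (extChartAt I x₀ x)).comp
        (differential I (extChartAt I x₀) x) := by
  have hs : x ∈ (extChartAt I x₀).source := by rwa [extChartAt_source]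
  have hd : DifferentiableAt ℝ (f ∘ (extChartAt I x₀).symm) (extChartAt I x₀ x) :=
    (MDifferentiableAt.comp_of_eq (x := extChartAt I x₀ x) (y := x) hf
      (mdifferentiableAt_extChartAt_symm_of_mem ((extChartAt I x₀).map_source hs)) ((extChartAt I x₀).left_inv hs)).differentiableAt
  refine ⟨hd, ?_⟩
  rw [← differential_comp hd (mdifferentiableAt_extChartAt hx)]
  refine differential_congr ?_
  filter_upwards [(isOpen_extChartAt_source (I := I) x₀).mem_nhds hs] with y hy
  exact (congrArg f ((extChartAt I x₀).left_inv hy)).symm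

/-- Pulling a vector field back to the model space along the inverse chart gives its components. -/
lemma mpullback_extChartAt_symm {x₀ : M} {z : E} (hz : z ∈ (extChartAt I x₀).target)
    (X : Π x : M, TangentSpace I x) :
    (mpullback 𝓘(ℝ, E) I (extChartAt I x₀).symm X z : E) =
      localRep x₀ X ((extChartAt I x₀).symm z) := by
  have h1 := mfderiv_extChartAt_comp_mfderivWithin_extChartAt_symm (I := I) hz
  have h2 := mfderivWithin_extChartAt_symm_comp_mfderiv_extChartAt (I := I) hz
  rw [I.range_eq_univ, mfderivWithin_univ] at h1 h2
  have hs : (extChartAt I x₀).symm z ∈ (chartAt H x₀).source := by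
    rw [← extChartAt_source (I := I)]; exact (extChartAt I x₀).map_target hz
  rw [localRep_eq hs, mpullback_apply]
  exact congrArg (fun L : E →L[ℝ] E ↦ L (X ((extChartAt I x₀).symm z)))
    (ContinuousLinearMap.inverse_eq h2 h1)

/-- The Lie bracket in the chart at `x₀`: its components are `V(Wⁱ) - W(Vⁱ)`. -/
lemma localRep_mlieBracket [CompleteSpace E] {x₀ x : M} (hx : x ∈ (chartAt H x₀).source)
    {V W : Π x : M, TangentSpace I x}
    (hV : MDifferentiableAt I I.tangent (fun x ↦ (⟨x, V x⟩ : TangentBundle I M)) x)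
    (hW : MDifferentiableAt I I.tangent (fun x ↦ (⟨x, W x⟩ : TangentBundle I M)) x) :
    localRep x₀ (mlieBracket I V W) x =
      differential I (localRep x₀ W) x (V x) - differential I (localRep x₀ V) x (W x) := by
  have hs : x ∈ (extChartAt I x₀).source := by rwa [extChartAt_source]
  have hz := (extChartAt I x₀).map_source hs
  have ez := (extChartAt I x₀).left_inv hs
  set z := extChartAt I x₀ x with hzdef
  have hsymm : ContMDiffAt 𝓘(ℝ, E) I ∞ (extChartAt I x₀).symm z :=
    (contMDiffOn_extChartAt_symm x₀).contMDiffAt ((isOpen_extChartAt_target x₀).mem_nhds hz)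
  have : IsManifold I (minSmoothness ℝ 2) M := by
    rw [minSmoothness_of_isRCLikeNormedField]; exact IsManifold.of_le (n := ∞) ENat.LEInfty.out
  have key := mpullback_mlieBracket (I := 𝓘(ℝ, E)) (I' := I) (n := ∞) (f := (extChartAt I x₀).symm)
    (x₀ := z) (V := V) (W := W) (by rwa [ez]) (by rwa [ez]) hsymm
    (by rw [minSmoothness_of_isRCLikeNormedField]; exact ENat.LEInfty.out)
  have hpull (X : Π x : M, TangentSpace I x) :
      (mpullback 𝓘(ℝ, E) I (extChartAt I x₀).symm X : E → E) =ᶠ[nhds z]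
        (localRep x₀ X ∘ (extChartAt I x₀).symm) := by
    filter_upwards [(isOpen_extChartAt_target x₀).mem_nhds hz] with z' hz'
    exact mpullback_extChartAt_symm hz' X
  have hb : mlieBracket 𝓘(ℝ, E) (mpullback 𝓘(ℝ, E) I (extChartAt I x₀).symm V)
      (mpullback 𝓘(ℝ, E) I (extChartAt I x₀).symm W) z =
      lieBracket ℝ (localRep x₀ V ∘ (extChartAt I x₀).symm)
        (localRep x₀ W ∘ (extChartAt I x₀).symm) z := by
    refine (congrFun (mlieBracketWithin_eq_lieBracketWithin (s := Set.univ)) z).trans ?_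
    refine (congrFun lieBracketWithin_univ z).trans ?_
    exact Filter.EventuallyEq.lieBracket_vectorField_eq (hpull V) (hpull W)
  have k1 : localRep x₀ (mlieBracket I V W) x = mpullback 𝓘(ℝ, E) I (extChartAt I x₀).symm
      (mlieBracket I V W) z := by
    rw [mpullback_extChartAt_symm hz, ez]
  rw [k1, key, hb, lieBracket_eq]
  rw [(differential_eq_fderiv hx (mdifferentiableAt_localRep hV hx)).2,
    (differential_eq_fderiv hx (mdifferentiableAt_localRep hW hx)).2]
  simp only [Function.comp_apply, ez, ← hzdef]
  rw [localRep_eq hx, localRep_eq hx]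
  rfl

end Coordinates

/-! ### The Lie derivative of a metric is a tensor -/

section Tensoriality

variable {E : Type*} [NormedAddCommGroup E] [NormedSpace ℝ E] {H : Type*} [TopologicalSpace H]
  {I : ModelWithCorners ℝ E H} {M : Type*} [TopologicalSpace M] [ChartedSpace H M]
  [IsManifold I ∞ M]

/-- A metric in the preferred chart at `p`, as a smooth family of bilinear forms on `E`. -/
lemma exists_metric_localRep (g : SmoothMetric I M) (p : M) :
    ∃ b : M → E →L[ℝ] E →L[ℝ] ℝ, MDifferentiableAt I 𝓘(ℝ, E →L[ℝ] E →L[ℝ] ℝ) b p ∧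
      ∀ x ∈ (chartAt H p).source, ∀ Y Z : Π x : M, TangentSpace I x,
        g.inner x (Y x) (Z x) = b x (localRep p Y x) (localRep p Z x) := by
  have h := ((contMDiffAt_hom_bundle _).1 (g.contMDiff p)).2
  refine ⟨_, h.mdifferentiableAt (by simp), fun x hx Y Z ↦ ?_⟩
  have hx' : x ∈ (trivializationAt E (TangentSpace I) p).baseSet := hx
  have h := inCoordinates_apply_eq₂ (F₁ := E) (F₂ := E) (F₃ := ℝ)
    (E₁ := (TangentSpace I : M → Type _))
    (E₂ := (TangentSpace I : M → Type _)) (E₃ := Bundle.Trivial M ℝ)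
    (ϕ := g.inner x) (v := localRep p Y x) (w := localRep p Z x) hx' hx' (x₀ := p) (by simp)
  have ht : (trivializationAt ℝ (Bundle.Trivial M ℝ) p).linearMapAt ℝ x =
      LinearMap.id := Bundle.Trivial.linearMapAt_trivialization ℝ _ _ x
  have hs (X : Π x : M, TangentSpace I x) :
      (trivializationAt E (TangentSpace I) p).symm x (localRep p X x) = X x :=
    (trivializationAt E (TangentSpace I) p).symm_apply_apply_mk hx' (X x)
  refine Eq.trans ?_ (h.trans (congrArg (fun L : ℝ →ₗ[ℝ] ℝ ↦ L _) ht)).symm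
  rw [hs, hs]
  rfl

/-- The Lie derivative of a metric is a tensor: its value at `p` on two vector fields depends
only on their values at `p`, and bilinearly so. In coordinates, the derivatives of `Y` and `Z` in
`V(g(Y, Z))` cancel against those in the brackets. -/
lemma exists_lieDerivMetric_eq [I.Boundaryless] [CompleteSpace E] (g : SmoothMetric I M)
    {V : Π x : M, TangentSpace I x} (hV : IsSmoothField V) (p : M) :
    ∃ T : E →L[ℝ] E →L[ℝ] ℝ, ∀ Y Z : Π x : M, TangentSpace I x,
      IsSmoothField Y → IsSmoothField Z → lieDerivMetric g V Y Z p = T (Y p) (Z p) := by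
  obtain ⟨b, hb, hg⟩ := exists_metric_localRep g p
  have hp := mem_chart_source H p
  refine ⟨differential I b p (V p) +
    (b p).bilinearComp (differential I (localRep p V) p) (.id ℝ E) +
    (b p).bilinearComp (.id ℝ E) (differential I (localRep p V) p), fun Y Z hY hZ ↦ ?_⟩
  have dY := mdifferentiableAt_localRep (hY.mdifferentiableAt p) hp
  have dZ := mdifferentiableAt_localRep (hZ.mdifferentiableAt p) hp
  have h1 : mvfderiv I (fun z ↦ g.inner z (Y z) (Z z)) p (V p) =
      differential I (fun x ↦ b x (localRep p Y x) (localRep p Z x)) p (V p) := by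
    refine congrArg (fun L : E →L[ℝ] ℝ ↦ L (V p)) (differential_congr (I := I) ?_)
    filter_upwards [chart_source_mem_nhds H p] with x hx using hg x hx Y Z
  have hbr (W : Π x : M, TangentSpace I x) (hW : IsSmoothField W) :
      localRep p (mlieBracket I V W) p =
      differential I (localRep p W) p (V p) - differential I (localRep p V) p (W p) :=
    localRep_mlieBracket hp (hV.mdifferentiableAt p) (hW.mdifferentiableAt p)
  have hd (v : E) : differential I (fun x ↦ b x (localRep p Y x) (localRep p Z x)) p v =
      differential I b p v (localRep p Y p) (localRep p Z p) +
        b p (differential I (localRep p Y) p v) (localRep p Z p) +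
        b p (localRep p Y p) (differential I (localRep p Z) p v) := by
    rw [differential_clm_apply (hb.clm_apply dY) dZ, differential_clm_apply hb dY, add_apply]
  have halg (A : E →L[ℝ] E) (v y z y' z' : E) :
      differential I b p v y z + b p y' z + b p y z' - b p (y' - A y) z - b p y (z' - A z) =
        (differential I b p v + (b p).bilinearComp A (.id ℝ E) + (b p).bilinearComp (.id ℝ E) A)
          y z := by
    simp only [map_sub, add_apply, sub_apply, ContinuousLinearMap.bilinearComp_apply,
      ContinuousLinearMap.id_apply]
    ring
  rw [lieDerivMetric, h1, hg p hp (mlieBracket I V Y) Z, hg p hp Y (mlieBracket I V Z),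
    hbr Y hY, hbr Z hZ, hd (V p), localRep_self, localRep_self]
  exact halg _ _ _ _ _ _

end Tensoriality

/-! ### Brackets of complete and vertical lifts -/

section Lifts

variable {E : Type*} [NormedAddCommGroup E] [NormedSpace ℝ E] {H : Type*} [TopologicalSpace H]
  {I : ModelWithCorners ℝ E H} {M : Type*} [TopologicalSpace M] [ChartedSpace H M]
  [IsManifold I ∞ M] {F : Type*} [NormedAddCommGroup F] [NormedSpace ℝ F]

instance [I.Boundaryless] : I.tangent.Boundaryless :=
  inferInstanceAs (I.prod 𝓘(ℝ, E)).Boundaryless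

lemma IsSmoothField.verticalLift {X : Π x : M, TangentSpace I x} (hX : IsSmoothField X) :
    IsSmoothField (TangentLift.verticalLift X) :=
  contMDiff_verticalLift hX

/-- A function pulled back along `π : TM → M` is differentiated along the horizontal component. -/
lemma differential_comp_proj {f : M → F} {p : TangentBundle I M}
    (hf : MDifferentiableAt I 𝓘(ℝ, F) f p.1) (u : E × E) :
    MDifferentiableAt I.tangent 𝓘(ℝ, F) (fun q : TangentBundle I M ↦ f q.1) p ∧
    differential I.tangent (fun q : TangentBundle I M ↦ f q.1) p u = differential I f p.1 u.1 := by
  have hπ : MDifferentiableAt I.tangent I (fun q : TangentBundle I M ↦ q.1) p :=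
    (contMDiff_proj (n := ∞) (TangentSpace I)).mdifferentiableAt (by simp)
  have h0 := mfderiv_tangentBundle_apply (f := (id : TangentBundle I M → TangentBundle I M))
    (J := I.tangent) mdifferentiableAt_id p rfl u
  have h1 : (mfderiv I.tangent I (fun q : TangentBundle I M ↦ q.1) p u : E) = u.1 := by
    have := congrArg Prod.fst h0
    rw [mfderiv_id] at this
    exact this.symm
  refine ⟨MDifferentiableAt.comp p hf hπ, ?_⟩
  have h2 := (hf.hasMFDerivAt.comp p hπ.hasMFDerivAt).mfderiv
  refine (congrArg (fun L : E × E →L[ℝ] F ↦ L u) h2).trans ?_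
  exact congrArg (differential I f p.1) h1

/-- In the chart of `TM` at `p`, the vertical component of a tangent vector `u` at `p` is the
derivative of the fibre coordinate. -/
lemma differential_fiber (p : TangentBundle I M) (u : E × E) :
    MDifferentiableAt I.tangent 𝓘(ℝ, E)
      (fun q : TangentBundle I M ↦ (trivializationAt E (TangentSpace I) p.1 q).2) p ∧
    differential I.tangent
      (fun q : TangentBundle I M ↦ (trivializationAt E (TangentSpace I) p.1 q).2) p u = u.2 := by
  have h0 := mfderiv_tangentBundle_apply (f := (id : TangentBundle I M → TangentBundle I M))
    (J := I.tangent) mdifferentiableAt_id p rfl u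
  have := congrArg Prod.snd h0
  rw [mfderiv_id] at this
  exact ⟨((mdifferentiableAt_totalSpace I _).1
    (mdifferentiableAt_id (I := I.tangent) (x := p))).2, this.symm⟩

lemma differential_extChartAt_self (x : M) :
    differential I (extChartAt I x) x = ContinuousLinearMap.id ℝ E :=
  mfderiv_extChartAt_self

lemma differential_extChartAt_eventuallyEq_localRep {x₀ x : M} (hx : x ∈ (chartAt H x₀).source)
    (X : Π x : M, TangentSpace I x) :
    (fun y ↦ differential I (extChartAt I x₀) y (X y)) =ᶠ[nhds x] localRep x₀ X := by
  filter_upwards [(chartAt H x₀).open_source.mem_nhds hx] with y hy using (localRep_eq hy X).symm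

lemma eventually_proj_mem_chart_source (p : TangentBundle I M) :
    ∀ᶠ q in nhds p, q.1 ∈ (chartAt H p.1).source :=
  ((FiberBundle.continuous_proj E (TangentSpace I : M → Type _)).tendsto p).eventually
    (chart_source_mem_nhds H p.1)

variable [I.Boundaryless]

/-- The differential `df`, as a function on `TM`, differentiated along tangent vectors of `TM`, and
the derivative `X(f)` differentiated along tangent vectors of `M`. Both involve the second
derivative `B` of `f` in the preferred chart. -/
lemma exists_hessian {f : M → F} {p : TangentBundle I M}
    (hf : ContMDiffAt I 𝓘(ℝ, F) ∞ f p.1) :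
    ∃ B : E →L[ℝ] E →L[ℝ] F, (∀ v w, B v w = B w v) ∧
      MDifferentiableAt I.tangent 𝓘(ℝ, F)
        (fun q : TangentBundle I M ↦ differential I f q.1 q.2) p ∧
      (∀ u : E × E, differential I.tangent
        (fun q : TangentBundle I M ↦ differential I f q.1 q.2) p u =
          B u.1 p.2 + differential I f p.1 u.2) ∧
      ∀ X : Π x : M, TangentSpace I x, IsSmoothField X →
        MDifferentiableAt I 𝓘(ℝ, F) (fun x ↦ differential I f x (X x)) p.1 ∧
        ∀ w : E, differential I (fun x ↦ differential I f x (X x)) p.1 w =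
          B w (X p.1) + differential I f p.1 (differential I (localRep p.1 X) p.1 w) := by
  set x₀ := p.1 with hx₀
  have hp := mem_chart_source H x₀
  set e := extChartAt I x₀ with he
  have hfe : ContDiffAt ℝ ∞ (f ∘ e.symm) (e x₀) := by
    have hs : ContMDiffAt 𝓘(ℝ, E) I ∞ e.symm (e x₀) :=
      (contMDiffOn_extChartAt_symm x₀).contMDiffAt (extChartAt_target_mem_nhds x₀)
    exact (ContMDiffAt.comp_of_eq (x := e x₀) (y := x₀) hf hs (extChartAt_to_inv x₀)).contDiffAt
  let D := fderiv ℝ (f ∘ e.symm)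
  have hD : DifferentiableAt ℝ D (e x₀) :=
    (hfe.fderiv_right (m := 1) (by
      rw [one_add_one_eq_two]; exact ENat.LEInfty.out)).differentiableAt (by simp)
  have hfd : ∀ᶠ x in nhds x₀, MDifferentiableAt I 𝓘(ℝ, F) f x := by
    filter_upwards [(contMDiffAt_iff_contMDiffAt_nhds (n := 2) (by simp)).1
      (hf.of_le ENat.LEInfty.out)] with x hx using hx.mdifferentiableAt (by simp)
  -- the differential of `f` at nearby points, read in the chart
  have hloc : ∀ᶠ x in nhds x₀, differential I f x = (D (e x)).comp (differential I e x) := by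
    filter_upwards [hfd, chart_source_mem_nhds H x₀] with x h1 h2
    exact (differential_eq_fderiv h2 h1).2
  have hec : MDifferentiableAt I 𝓘(ℝ, E) e x₀ := mdifferentiableAt_extChartAt hp
  have hDe : MDifferentiableAt I 𝓘(ℝ, E →L[ℝ] F) (fun x ↦ D (e x)) x₀ :=
    hD.comp_mdifferentiableAt hec
  have hDe' : differential I (fun x ↦ D (e x)) x₀ = fderiv ℝ D (e x₀) := by
    refine (differential_comp hD hec).trans ?_
    rw [differential_extChartAt_self]
    rfl
  have hself : differential I f x₀ = D (e x₀) := by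
    rw [hloc.self_of_nhds, differential_extChartAt_self]
    rfl
  have hsym : IsSymmSndFDerivAt ℝ (f ∘ e.symm) (e x₀) := hfe.isSymmSndFDerivAt (by
    rw [minSmoothness_of_isRCLikeNormedField]; exact ENat.LEInfty.out)
  have hTM : (fun q : TangentBundle I M ↦ differential I f q.1 q.2) =ᶠ[nhds p]
      fun q ↦ D (e q.1) ((trivializationAt E (TangentSpace I) x₀ q).2) := by
    have hc : Filter.Tendsto (fun q : TangentBundle I M ↦ q.1) (nhds p) (nhds x₀) :=
      (FiberBundle.continuous_proj E (TangentSpace I : M → Type _)).tendsto p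
    filter_upwards [hc.eventually hloc, hc.eventually (chart_source_mem_nhds H x₀)] with q h1 h2
    rw [h1]
    exact congrArg (D (e q.1)) (trivializationAt_snd h2 q.2).symm
  have hA (u : E × E) := differential_comp_proj (p := p) hDe u
  have hB (u : E × E) := differential_fiber p u
  refine ⟨fderiv ℝ D (e x₀), fun v w ↦ hsym v w, ?_, fun u ↦ ?_, fun X hX ↦ ?_⟩
  · exact ((hA 0).1.clm_apply (hB 0).1).congr_of_eventuallyEq hTM
  · rw [differential_congr hTM]
    refine (differential_clm_apply (hA 0).1 (hB 0).1 u).trans ?_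
    rw [(hA u).2, (hB u).2, hself, hDe']
    congr 1
    exact congrArg (fderiv ℝ D (e x₀) u.1) (trivializationAt_self_snd x₀ p.2)
  · have hX' : (fun x ↦ differential I f x (X x)) =ᶠ[nhds x₀]
        fun x ↦ D (e x) (localRep x₀ X x) := by
      filter_upwards [hloc, chart_source_mem_nhds H x₀] with x h1 h2
      rw [h1, localRep_eq h2]
      rfl
    have hXd := mdifferentiableAt_localRep (hX.mdifferentiableAt x₀) hp
    refine ⟨(hDe.clm_apply hXd).congr_of_eventuallyEq hX', fun w ↦ ?_⟩
    rw [differential_congr hX', differential_clm_apply hDe hXd, localRep_self, hself, hDe']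

/-- `X^c(df) = d(Xf)` on functions of the form `df : TM → F`. -/
lemma differential_completeLift {f : M → F} {p : TangentBundle I M}
    (hf : ContMDiffAt I 𝓘(ℝ, F) ∞ f p.1) {X : Π x : M, TangentSpace I x} (hX : IsSmoothField X) :
    differential I.tangent (fun q : TangentBundle I M ↦ differential I f q.1 q.2) p
        (completeLift X p) =
      differential I (fun x ↦ differential I f x (X x)) p.1 p.2 := by
  obtain ⟨B, hB, -, h1, h2⟩ := exists_hessian hf
  refine (h1 (X p.1, differential I (localRep p.1 X) p.1 p.2)).trans ?_
  exact (congrArg (· + _) (hB _ _)).trans ((h2 X hX).2 p.2).symm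

/-- `X^v(df) = X(f)` on functions of the form `df : TM → F`. -/
lemma differential_verticalLift {f : M → F} {p : TangentBundle I M}
    (hf : ContMDiffAt I 𝓘(ℝ, F) ∞ f p.1) (X : Π x : M, TangentSpace I x) :
    differential I.tangent (fun q : TangentBundle I M ↦ differential I f q.1 q.2) p
        (verticalLift X p) = differential I f p.1 (X p.1) := by
  obtain ⟨B, -, -, h1, -⟩ := exists_hessian hf
  refine (congrArg (differential I.tangent _ p) (verticalLift_eq X p)).trans ?_
  have h0 : B 0 p.2 = 0 := by rw [map_zero]; rfl
  exact (h1 (0, X p.1)).trans ((congrArg (· + _) h0).trans (zero_add _))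

/-- The components of a vector field on `TM` in the chart induced by the chart `e` at `p.1` are its
derivatives of `e ∘ π` and of `de`. -/
lemma localRep_tangent {p q : TangentBundle I M} (hq : q.1 ∈ (chartAt H p.1).source)
    (Ξ : Π p : TangentBundle I M, TangentSpace I.tangent p) :
    (localRep p Ξ q : E × E) = (differential I (extChartAt I p.1) q.1 (Ξ q : E × E).1,
      differential I.tangent (fun q : TangentBundle I M ↦
        differential I (extChartAt I p.1) q.1 q.2) q (Ξ q)) := by
  have he : ContMDiffAt I 𝓘(ℝ, E) ∞ (extChartAt I p.1) q.1 := contMDiffAt_extChartAt' hq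
  obtain ⟨B, -, hd, -, -⟩ := exists_hessian he
  have h1 := differential_comp_proj (p := q) (he.mdifferentiableAt (by simp))
  have hchart : (extChartAt I.tangent p : TangentBundle I M → E × E) =ᶠ[nhds q]
      fun q ↦ (extChartAt I p.1 q.1, differential I (extChartAt I p.1) q.1 q.2) := by
    have hc : Filter.Tendsto (fun q : TangentBundle I M ↦ q.1) (nhds q) (nhds q.1) :=
      (FiberBundle.continuous_proj E (TangentSpace I : M → Type _)).tendsto q
    filter_upwards [hc.eventually ((chartAt H p.1).open_source.mem_nhds hq)] with q' h
    have h2 : extChartAt I.tangent p q' =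
        (extChartAt I p.1 q'.1, (trivializationAt E (TangentSpace I) p.1 q').2) := by
      simp only [FiberBundle.extChartAt, ModelWithCorners.tangent]
      rfl
    exact h2.trans (Prod.ext rfl (trivializationAt_snd h q'.2))
  have hmem : q ∈ (chartAt (ModelProd H E) p).source := by
    rwa [TangentBundle.mem_chart_source_iff]
  rw [localRep_eq hmem, differential_congr hchart, differential_prodMk (h1 0).1 hd]
  exact Prod.ext (h1 (Ξ q)).2 rfl

/-- In the fixed chart of `TM` at `p`, the complete lift reads `(X, dX)` at all nearby points `q`,
whereas its definition uses at each `q` the chart centred at `q`. -/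
lemma localRep_completeLift {p q : TangentBundle I M} (hq : q.1 ∈ (chartAt H p.1).source)
    {X : Π x : M, TangentSpace I x} (hX : IsSmoothField X) :
    (localRep p (completeLift X) q : E × E) =
      (localRep p.1 X q.1, differential I (localRep p.1 X) q.1 q.2) := by
  rw [localRep_tangent hq, differential_completeLift (contMDiffAt_extChartAt' hq) hX,
    differential_congr (differential_extChartAt_eventuallyEq_localRep hq X), localRep_eq hq]
  rfl

lemma localRep_verticalLift {p q : TangentBundle I M} (hq : q.1 ∈ (chartAt H p.1).source)
    (X : Π x : M, TangentSpace I x) :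
    (localRep p (verticalLift X) q : E × E) = (0, localRep p.1 X q.1) := by
  rw [localRep_tangent hq, differential_verticalLift (contMDiffAt_extChartAt' hq),
    ← localRep_eq hq X]
  refine Prod.ext ?_ rfl
  refine (congrArg (fun u : E × E ↦ differential I (extChartAt I p.1) q.1 u.1)
    (verticalLift_eq X q)).trans ?_
  exact map_zero _

lemma differential_localRep_completeLift {X : Π x : M, TangentSpace I x} (hX : IsSmoothField X)
    (p : TangentBundle I M) (u : E × E) :
    (differential I.tangent (localRep p (completeLift X)) p u : E × E) =
      (differential I (localRep p.1 X) p.1 u.1, differential I.tangent (fun q : TangentBundle I M ↦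
        differential I (localRep p.1 X) q.1 q.2) p u) := by
  have hc := hX.contMDiffAt_localRep (mem_chart_source H p.1)
  have h : (localRep p (completeLift X) : TangentBundle I M → E × E) =ᶠ[nhds p]
      fun q ↦ (localRep p.1 X q.1, differential I (localRep p.1 X) q.1 q.2) := by
    filter_upwards [eventually_proj_mem_chart_source p] with q hq using localRep_completeLift hq hX
  obtain ⟨B, -, hd, -, -⟩ := exists_hessian hc
  have h1 := differential_comp_proj (p := p) (hc.mdifferentiableAt (by simp)) u
  rw [differential_congr h, differential_prodMk h1.1 hd]
  exact Prod.ext h1.2 rfl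

lemma differential_localRep_verticalLift {X : Π x : M, TangentSpace I x} (hX : IsSmoothField X)
    (p : TangentBundle I M) (u : E × E) :
    (differential I.tangent (localRep p (verticalLift X)) p u : E × E) =
      (0, differential I (localRep p.1 X) p.1 u.1) := by
  have hc := hX.contMDiffAt_localRep (mem_chart_source H p.1)
  have h : (localRep p (verticalLift X) : TangentBundle I M → E × E) =ᶠ[nhds p]
      fun q ↦ (0, localRep p.1 X q.1) := by
    filter_upwards [eventually_proj_mem_chart_source p] with q hq using localRep_verticalLift hq X
  have h1 := differential_comp_proj (p := p) (hc.mdifferentiableAt (by simp)) u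
  rw [differential_congr h, differential_prodMk mdifferentiableAt_const h1.1]
  refine Prod.ext ?_ h1.2
  exact congrArg (fun L : E × E →L[ℝ] E ↦ L u)
    (mfderiv_const (I := I.tangent) (I' := 𝓘(ℝ, E)) (c := (0 : E)) (x := p))

variable [CompleteSpace E]

/-- At the centre of a chart the components of a tangent vector are the vector itself. -/
lemma mlieBracket_eq_localRep {V W : Π x : M, TangentSpace I x} {x : M}
    (hV : MDifferentiableAt I I.tangent (fun x ↦ (⟨x, V x⟩ : TangentBundle I M)) x)
    (hW : MDifferentiableAt I I.tangent (fun x ↦ (⟨x, W x⟩ : TangentBundle I M)) x) :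
    (mlieBracket I V W x : E) =
      differential I (localRep x W) x (V x) - differential I (localRep x V) x (W x) := by
  have h := localRep_mlieBracket (mem_chart_source H x) hV hW
  exact (localRep_self x (mlieBracket I V W)).symm.trans h

/-- `[X^c, Y^c] = [X, Y]^c`. -/
lemma mlieBracket_completeLift_completeLift {X Y : Π x : M, TangentSpace I x}
    (hX : IsSmoothField X) (hY : IsSmoothField Y) (hXc : IsSmoothField (completeLift X))
    (hYc : IsSmoothField (completeLift Y)) :
    mlieBracket I.tangent (completeLift X) (completeLift Y) =
      completeLift (mlieBracket I X Y) := by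
  funext p
  have hp := mem_chart_source H p.1
  have cX := hX.contMDiffAt_localRep hp
  have cY := hY.contMDiffAt_localRep hp
  refine (mlieBracket_eq_localRep (hXc.mdifferentiableAt p) (hYc.mdifferentiableAt p)).trans ?_
  refine (congrArg₂ (fun a b : E × E ↦ a - b)
    ((differential_localRep_completeLift hY p (completeLift X p)).trans
      (congrArg (Prod.mk _) (differential_completeLift cY hX)))
    ((differential_localRep_completeLift hX p (completeLift Y p)).trans
      (congrArg (Prod.mk _) (differential_completeLift cX hY)))).trans ?_
  refine Prod.ext ?_ ?_
  · exact (mlieBracket_eq_localRep (hX.mdifferentiableAt p.1) (hY.mdifferentiableAt p.1)).symm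
  · have h : localRep p.1 (mlieBracket I X Y) =ᶠ[nhds p.1] fun x ↦
        differential I (localRep p.1 Y) x (X x) - differential I (localRep p.1 X) x (Y x) := by
      filter_upwards [chart_source_mem_nhds H p.1] with x hx
      exact localRep_mlieBracket hx (hX.mdifferentiableAt x) (hY.mdifferentiableAt x)
    obtain ⟨B, -, -, -, h1⟩ := exists_hessian cY
    obtain ⟨B', -, -, -, h2⟩ := exists_hessian cX
    have h3 : differential I (localRep p.1 (mlieBracket I X Y)) p.1 =
        differential I (fun x ↦ differential I (localRep p.1 Y) x (X x)) p.1 -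
          differential I (fun x ↦ differential I (localRep p.1 X) x (Y x)) p.1 :=
      (differential_congr h).trans (mfderiv_sub (h1 X hX).1 (h2 Y hY).1)
    exact (congrArg (fun L : E →L[ℝ] E ↦ L p.2) h3).symm

/-- `[X^c, Y^v] = [X, Y]^v`. -/
lemma mlieBracket_completeLift_verticalLift {X Y : Π x : M, TangentSpace I x}
    (hX : IsSmoothField X) (hY : IsSmoothField Y) (hXc : IsSmoothField (completeLift X)) :
    mlieBracket I.tangent (completeLift X) (verticalLift Y) =
      verticalLift (mlieBracket I X Y) := by
  funext p
  have cX := hX.contMDiffAt_localRep (mem_chart_source H p.1)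
  refine (mlieBracket_eq_localRep (hXc.mdifferentiableAt p)
    (hY.verticalLift.mdifferentiableAt p)).trans ?_
  refine (congrArg₂ (fun a b : E × E ↦ a - b)
    (differential_localRep_verticalLift hY p (completeLift X p))
    ((differential_localRep_completeLift hX p (verticalLift Y p)).trans
      (congrArg (Prod.mk _) (differential_verticalLift cX Y)))).trans ?_
  refine Eq.trans ?_ (verticalLift_eq (mlieBracket I X Y) p).symm
  have h0 : (verticalLift Y p : E × E).1 = 0 := congrArg Prod.fst (verticalLift_eq Y p)
  rw [h0, map_zero]
  refine Prod.ext (sub_zero (0 : E)) ?_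
  exact (mlieBracket_eq_localRep (hX.mdifferentiableAt p.1) (hY.mdifferentiableAt p.1)).symm

/-- `[X^v, Y^v] = 0`. -/
lemma mlieBracket_verticalLift_verticalLift {X Y : Π x : M, TangentSpace I x}
    (hX : IsSmoothField X) (hY : IsSmoothField Y) :
    mlieBracket I.tangent (verticalLift X) (verticalLift Y) = 0 := by
  funext p
  refine (mlieBracket_eq_localRep (hX.verticalLift.mdifferentiableAt p)
    (hY.verticalLift.mdifferentiableAt p)).trans ?_
  refine (congrArg₂ (fun a b : E × E ↦ a - b)
    (differential_localRep_verticalLift hY p (verticalLift X p))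
    (differential_localRep_verticalLift hX p (verticalLift Y p))).trans ?_
  have h0 (Z : Π x : M, TangentSpace I x) : (verticalLift Z p : E × E).1 = 0 :=
    congrArg Prod.fst (verticalLift_eq Z p)
  rw [h0, h0, map_zero, map_zero]
  exact sub_zero (0 : E × E)

end Lifts

/-! ### Left invariant fields and metrics -/

section LeftInvariant

variable {E : Type*} [NormedAddCommGroup E] [NormedSpace ℝ E] {H : Type*} [TopologicalSpace H]
  {I : ModelWithCorners ℝ E H}

/-- If `g(Y, Z)` is constant, only the brackets contribute to `(L_X g)(Y, Z)`. -/
lemma lieDerivMetric_of_inner_const {M : Type*} [TopologicalSpace M] [ChartedSpace H M]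
    [IsManifold I ∞ M] (g : SmoothMetric I M) (X : Π x : M, TangentSpace I x)
    {Y Z : Π x : M, TangentSpace I x} {c : ℝ} (hc : ∀ x, g.inner x (Y x) (Z x) = c) (x : M) :
    lieDerivMetric g X Y Z x =
      -(g.inner x (mlieBracket I X Y x) (Z x) + g.inner x (Y x) (mlieBracket I X Z x)) := by
  have h : mvfderiv I (fun z ↦ g.inner z (Y z) (Z z)) x (X x) = 0 := by
    rw [funext hc]
    exact congrArg (fun L : E →L[ℝ] ℝ ↦ L (X x))
      (mfderiv_const (I := I) (I' := 𝓘(ℝ, ℝ)) (c := c) (x := x))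
  rw [lieDerivMetric, h]
  ring

variable {G : Type*} [TopologicalSpace G] [ChartedSpace H G] [Group G] [LieGroup I ∞ G]

/-- The symmetric form `(Y, Z) ↦ g([X, Y], Z) + g(Y, [X, Z])` on the Lie algebra. It vanishes if
and only if `ad X` is skew-adjoint. -/
noncomputable def adForm (g : SmoothMetric I G) (v w u : GroupLieAlgebra I G) : ℝ :=
  g.inner 1 ⁅v, w⁆ u + g.inner 1 w ⁅v, u⁆

lemma isSmoothField_leftInvariant (v : GroupLieAlgebra I G) :
    IsSmoothField (mulInvariantVectorField v : Π x : G, TangentSpace I x) :=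
  contMDiff_leftInvariant v

lemma IsLeftInvariantMetric.inner_mulInvariantVectorField {g : SmoothMetric I G}
    (hg : IsLeftInvariantMetric g) (w u : GroupLieAlgebra I G) (x : G) :
    g.inner x (mulInvariantVectorField w x) (mulInvariantVectorField u x) = g.inner 1 w u := by
  -- left translation by `x` lands in the tangent space at `x * 1`, which has to be moved to `x`
  have h (y : G) (hy : y = x) (a b : E) :
      g.inner y (show TangentSpace I y from a) (show TangentSpace I y from b) =
        g.inner x (show TangentSpace I x from a) (show TangentSpace I x from b) := by
    subst hy; rfl
  exact (h (x * 1) (mul_one x) _ _).symm.trans (hg x 1 w u)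

lemma mlieBracket_mulInvariantVectorField [CompleteSpace E] (v w : GroupLieAlgebra I G) :
    mlieBracket I (mulInvariantVectorField v) (mulInvariantVectorField w) =
      mulInvariantVectorField ⁅v, w⁆ :=
  (mulInvariantVector_mlieBracket v w).symm

lemma lieDerivMetric_mulInvariantVectorField [CompleteSpace E] {g : SmoothMetric I G}
    (hg : IsLeftInvariantMetric g) (v w u : GroupLieAlgebra I G) (x : G) :
    lieDerivMetric g (mulInvariantVectorField v) (mulInvariantVectorField w)
      (mulInvariantVectorField u) x = -adForm g v w u := by
  rw [lieDerivMetric_of_inner_const g _ (hg.inner_mulInvariantVectorField w u),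
    mlieBracket_mulInvariantVectorField, mlieBracket_mulInvariantVectorField,
    hg.inner_mulInvariantVectorField, hg.inner_mulInvariantVectorField, adForm]

/-- If `g([X, Y], Z) + g(Y, [X, Z])` is a multiple of `g(Y, Z)`, then it vanishes: since
`[X, X] = 0`, taking `Y = Z = X` shows that the factor is `0` unless `X = 0`. -/
lemma adForm_eq_zero_of_eq_mul {g : SmoothMetric I G} [CompleteSpace E]
    {v : GroupLieAlgebra I G} {c : ℝ}
    (h : ∀ w u, -adForm g v w u = 2 * c * g.inner 1 w u) (w u : GroupLieAlgebra I G) :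
    adForm g v w u = 0 := by
  rcases eq_or_ne v 0 with rfl | hv
  · simp [adForm]
  · have h1 := h v v
    have h2 : adForm g v v v = 0 := by simp [adForm]
    have h3 : c = 0 := by
      rw [h2, neg_zero] at h1
      simpa [(g.pos 1 v hv).ne'] using h1.symm
    simpa [h3] using h w u

lemma exists_mulInvariantVectorField_eq [FiniteDimensional ℝ E] (x : G) (a : TangentSpace I x) :
    ∃ v : GroupLieAlgebra I G, mulInvariantVectorField v x = a := by
  have h : Function.Injective
      ((show E →L[ℝ] E from mfderiv I I (fun h : G ↦ x * h) 1) : E →ₗ[ℝ] E) :=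
    mulInvariantVectorField_injective x
  exact LinearMap.injective_iff_surjective.1 h a

variable [I.Boundaryless] [FiniteDimensional ℝ E]

/-- A left invariant field `X` is conformal for a left invariant metric if and only if `ad X` is
skew-adjoint, so that it is then a Killing field. -/
lemma isConformalField_mulInvariantVectorField_iff {g : SmoothMetric I G}
    (hg : IsLeftInvariantMetric g) (v : GroupLieAlgebra I G) :
    IsConformalField g (mulInvariantVectorField v) ↔ ∀ w u, adForm g v w u = 0 := by
  have : CompleteSpace E := FiniteDimensional.complete ℝ E
  refine ⟨fun ⟨_, ρ, _, h⟩ ↦ adForm_eq_zero_of_eq_mul (c := ρ 1) fun w u ↦ ?_, fun h ↦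
    ⟨isSmoothField_leftInvariant v, fun _ ↦ 0, contMDiff_const, fun Y Z hY hZ x ↦ ?_⟩⟩
  · rw [← lieDerivMetric_mulInvariantVectorField hg v w u 1,
      h _ _ (isSmoothField_leftInvariant w) (isSmoothField_leftInvariant u),
      hg.inner_mulInvariantVectorField]
  · obtain ⟨T, hT⟩ := exists_lieDerivMetric_eq g (isSmoothField_leftInvariant v) x
    obtain ⟨w, hw⟩ := exists_mulInvariantVectorField_eq x (Y x)
    obtain ⟨u, hu⟩ := exists_mulInvariantVectorField_eq x (Z x)
    rw [hT Y Z hY hZ, ← hw, ← hu,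
      ← hT _ _ (isSmoothField_leftInvariant w) (isSmoothField_leftInvariant u),
      lieDerivMetric_mulInvariantVectorField hg, h]
    simp

end LeftInvariant

/-! ### The lifted metric on the tangent bundle of a Lie group -/

section LiftedMetric

variable {E : Type*} [NormedAddCommGroup E] [NormedSpace ℝ E] {H : Type*} [TopologicalSpace H]
  {I : ModelWithCorners ℝ E H}
  {G : Type*} [TopologicalSpace G] [ChartedSpace H G] [Group G] [LieGroup I ∞ G]

lemma isSmoothField_verticalLift (v : GroupLieAlgebra I G) :
    IsSmoothField (verticalLift (mulInvariantVectorField v : Π x : G, TangentSpace I x)) :=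
  (isSmoothField_leftInvariant v).verticalLift

variable [I.Boundaryless]

lemma isSmoothField_completeLift (v : GroupLieAlgebra I G) :
    IsSmoothField (completeLift (mulInvariantVectorField v : Π x : G, TangentSpace I x)) :=
  contMDiff_completeLift v

variable [FiniteDimensional ℝ E]

lemma liftedMetric_vertical_complete (g₁ g₂ : SmoothMetric I G) (v w : GroupLieAlgebra I G)
    (p : TangentBundle I G) :
    (liftedMetric g₁ g₂).inner p (verticalLift (mulInvariantVectorField v) p)
      (completeLift (mulInvariantVectorField w) p) = 0 :=
  ((liftedMetric g₁ g₂).symm p _ _).trans (liftedMetric_complete_vertical g₁ g₂ w v p)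

lemma mlieBracket_complete_complete (v w : GroupLieAlgebra I G) :
    mlieBracket I.tangent (completeLift (mulInvariantVectorField v : Π x : G, TangentSpace I x))
      (completeLift (mulInvariantVectorField w)) =
        completeLift (mulInvariantVectorField ⁅v, w⁆) := by
  have : CompleteSpace E := FiniteDimensional.complete ℝ E
  rw [mlieBracket_completeLift_completeLift (isSmoothField_leftInvariant v)
    (isSmoothField_leftInvariant w) (isSmoothField_completeLift v) (isSmoothField_completeLift w),
    mlieBracket_mulInvariantVectorField]

lemma mlieBracket_complete_vertical (v w : GroupLieAlgebra I G) :
    mlieBracket I.tangent (completeLift (mulInvariantVectorField v : Π x : G, TangentSpace I x))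
      (verticalLift (mulInvariantVectorField w)) =
        verticalLift (mulInvariantVectorField ⁅v, w⁆) := by
  have : CompleteSpace E := FiniteDimensional.complete ℝ E
  rw [mlieBracket_completeLift_verticalLift (isSmoothField_leftInvariant v)
    (isSmoothField_leftInvariant w) (isSmoothField_completeLift v),
    mlieBracket_mulInvariantVectorField]

lemma mlieBracket_vertical_complete (v w : GroupLieAlgebra I G) :
    mlieBracket I.tangent (verticalLift (mulInvariantVectorField v : Π x : G, TangentSpace I x))
      (completeLift (mulInvariantVectorField w)) =
        verticalLift (mulInvariantVectorField ⁅v, w⁆) := by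
  have : CompleteSpace E := FiniteDimensional.complete ℝ E
  rw [mlieBracket_swap, mlieBracket_complete_vertical, ← lie_skew v w]
  funext p
  have h (a : GroupLieAlgebra I G) : mulInvariantVectorField (-a) p.1 =
      -mulInvariantVectorField a p.1 := map_neg (mfderiv I I (fun h : G ↦ p.1 * h) 1) a
  rw [Pi.neg_apply, verticalLift_eq, verticalLift_eq, h]
  exact Prod.ext (neg_zero (G := E)) rfl

lemma mlieBracket_vertical_vertical (v w : GroupLieAlgebra I G) :
    mlieBracket I.tangent (verticalLift (mulInvariantVectorField v : Π x : G, TangentSpace I x))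
      (verticalLift (mulInvariantVectorField w)) = 0 := by
  have : CompleteSpace E := FiniteDimensional.complete ℝ E
  exact mlieBracket_verticalLift_verticalLift (isSmoothField_leftInvariant v)
    (isSmoothField_leftInvariant w)

/-- By tensoriality, `L_V g` vanishes at `p` if it does so on the frame of complete and vertical lifts
of left invariant fields. -/
lemma lieDerivMetric_eq_zero_of_lifts {g : SmoothMetric I.tangent (TangentBundle I G)}
    {V : Π p : TangentBundle I G, TangentSpace I.tangent p} (hV : IsSmoothField V)
    (p : TangentBundle I G)
    (hcc : ∀ w u : GroupLieAlgebra I G, lieDerivMetric g V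
      (completeLift (mulInvariantVectorField w)) (completeLift (mulInvariantVectorField u)) p = 0)
    (hcv : ∀ w u : GroupLieAlgebra I G, lieDerivMetric g V
      (completeLift (mulInvariantVectorField w)) (verticalLift (mulInvariantVectorField u)) p = 0)
    (hvc : ∀ w u : GroupLieAlgebra I G, lieDerivMetric g V
      (verticalLift (mulInvariantVectorField w)) (completeLift (mulInvariantVectorField u)) p = 0)
    (hvv : ∀ w u : GroupLieAlgebra I G, lieDerivMetric g V
      (verticalLift (mulInvariantVectorField w)) (verticalLift (mulInvariantVectorField u)) p = 0)
    {Y Z : Π p : TangentBundle I G, TangentSpace I.tangent p} (hY : IsSmoothField Y)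
    (hZ : IsSmoothField Z) : lieDerivMetric g V Y Z p = 0 := by
  have : CompleteSpace E := FiniteDimensional.complete ℝ E
  obtain ⟨T, hT⟩ := exists_lieDerivMetric_eq g hV p
  have hdec (A : TangentSpace I.tangent p) : ∃ a b : GroupLieAlgebra I G,
      A = completeLift (mulInvariantVectorField a) p +
        verticalLift (mulInvariantVectorField b) p :=
    ⟨_, _, ((liftEquiv p).apply_symm_apply A).symm⟩
  obtain ⟨a, b, hab⟩ := hdec (Y p)
  obtain ⟨c, d, hcd⟩ := hdec (Z p)
  have hadd (A B C D : E × E) (h1 : T A C = 0) (h2 : T A D = 0) (h3 : T B C = 0)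
      (h4 : T B D = 0) : T (A + B) (C + D) = 0 := by
    simp [h1, h2, h3, h4]
  have sc := isSmoothField_completeLift (I := I) (G := G)
  have sv := isSmoothField_verticalLift (I := I) (G := G)
  rw [hT Y Z hY hZ, hab, hcd]
  exact hadd _ _ _ _ ((hT _ _ (sc a) (sc c)).symm.trans (hcc a c))
    ((hT _ _ (sc a) (sv d)).symm.trans (hcv a d)) ((hT _ _ (sv b) (sc c)).symm.trans (hvc b c))
    ((hT _ _ (sv b) (sv d)).symm.trans (hvv b d))

variable (g₁ g₂ : SmoothMetric I G) (v w u : GroupLieAlgebra I G) (p : TangentBundle I G)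

lemma lieDerivMetric_complete_complete_complete :
    lieDerivMetric (liftedMetric g₁ g₂) (completeLift (mulInvariantVectorField v))
      (completeLift (mulInvariantVectorField w)) (completeLift (mulInvariantVectorField u)) p =
        -adForm g₁ v w u := by
  rw [lieDerivMetric_of_inner_const _ _ (liftedMetric_complete_complete g₁ g₂ w u),
    mlieBracket_complete_complete, mlieBracket_complete_complete,
    liftedMetric_complete_complete, liftedMetric_complete_complete, adForm]

lemma lieDerivMetric_complete_vertical_vertical :
    lieDerivMetric (liftedMetric g₁ g₂) (completeLift (mulInvariantVectorField v))
      (verticalLift (mulInvariantVectorField w)) (verticalLift (mulInvariantVectorField u)) p =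
        -adForm g₂ v w u := by
  rw [lieDerivMetric_of_inner_const _ _ (liftedMetric_vertical_vertical g₁ g₂ w u),
    mlieBracket_complete_vertical, mlieBracket_complete_vertical,
    liftedMetric_vertical_vertical, liftedMetric_vertical_vertical, adForm]

lemma lieDerivMetric_complete_complete_vertical :
    lieDerivMetric (liftedMetric g₁ g₂) (completeLift (mulInvariantVectorField v))
      (completeLift (mulInvariantVectorField w)) (verticalLift (mulInvariantVectorField u)) p =
        0 := by
  rw [lieDerivMetric_of_inner_const _ _ (liftedMetric_complete_vertical g₁ g₂ w u),
    mlieBracket_complete_complete, mlieBracket_complete_vertical,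
    liftedMetric_complete_vertical, liftedMetric_complete_vertical, add_zero, neg_zero]

lemma lieDerivMetric_complete_vertical_complete :
    lieDerivMetric (liftedMetric g₁ g₂) (completeLift (mulInvariantVectorField v))
      (verticalLift (mulInvariantVectorField w)) (completeLift (mulInvariantVectorField u)) p =
        0 := by
  rw [lieDerivMetric_of_inner_const _ _ (liftedMetric_vertical_complete g₁ g₂ w u),
    mlieBracket_complete_vertical, mlieBracket_complete_complete,
    liftedMetric_vertical_complete, liftedMetric_vertical_complete, add_zero, neg_zero]

lemma lieDerivMetric_vertical_complete_complete :
    lieDerivMetric (liftedMetric g₁ g₂) (verticalLift (mulInvariantVectorField v))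
      (completeLift (mulInvariantVectorField w)) (completeLift (mulInvariantVectorField u)) p =
        0 := by
  rw [lieDerivMetric_of_inner_const _ _ (liftedMetric_complete_complete g₁ g₂ w u),
    mlieBracket_vertical_complete, mlieBracket_vertical_complete,
    liftedMetric_vertical_complete, liftedMetric_complete_vertical, add_zero, neg_zero]

lemma lieDerivMetric_vertical_complete_vertical :
    lieDerivMetric (liftedMetric g₁ g₂) (verticalLift (mulInvariantVectorField v))
      (completeLift (mulInvariantVectorField w)) (verticalLift (mulInvariantVectorField u)) p =
        -g₂.inner 1 ⁅v, w⁆ u := by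
  rw [lieDerivMetric_of_inner_const _ _ (liftedMetric_complete_vertical g₁ g₂ w u),
    mlieBracket_vertical_complete, mlieBracket_vertical_vertical,
    liftedMetric_vertical_vertical, Pi.zero_apply, map_zero, add_zero]

lemma lieDerivMetric_vertical_vertical_complete :
    lieDerivMetric (liftedMetric g₁ g₂) (verticalLift (mulInvariantVectorField v))
      (verticalLift (mulInvariantVectorField w)) (completeLift (mulInvariantVectorField u)) p =
        -g₂.inner 1 w ⁅v, u⁆ := by
  rw [lieDerivMetric_of_inner_const _ _ (liftedMetric_vertical_complete g₁ g₂ w u),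
    mlieBracket_vertical_complete, mlieBracket_vertical_vertical,
    liftedMetric_vertical_vertical, Pi.zero_apply, map_zero, zero_apply, zero_add]

lemma lieDerivMetric_vertical_vertical_vertical :
    lieDerivMetric (liftedMetric g₁ g₂) (verticalLift (mulInvariantVectorField v))
      (verticalLift (mulInvariantVectorField w)) (verticalLift (mulInvariantVectorField u)) p =
        0 := by
  rw [lieDerivMetric_of_inner_const _ _ (liftedMetric_vertical_vertical g₁ g₂ w u),
    mlieBracket_vertical_vertical, mlieBracket_vertical_vertical,
    Pi.zero_apply, map_zero, map_zero, zero_apply, add_zero, neg_zero]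

/-- `L_{X^c} g̃` restricts to `L_X g₁` on complete lifts and to `L_X g₂` on vertical lifts, and vanishes
on mixed pairs. -/
lemma isConformalField_completeLift_iff :
    IsConformalField (liftedMetric g₁ g₂) (completeLift (mulInvariantVectorField v)) ↔
      (∀ w u, adForm g₁ v w u = 0) ∧ ∀ w u, adForm g₂ v w u = 0 := by
  have : CompleteSpace E := FiniteDimensional.complete ℝ E
  refine ⟨fun ⟨_, ρ, _, h⟩ ↦ ?_, fun ⟨h₁, h₂⟩ ↦
    ⟨isSmoothField_completeLift v, fun _ ↦ 0, contMDiff_const, fun Y Z hY hZ p ↦ ?_⟩⟩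
  · let p : TangentBundle I G := ⟨1, 0⟩
    refine ⟨adForm_eq_zero_of_eq_mul (c := ρ p) fun w u ↦ ?_,
      adForm_eq_zero_of_eq_mul (c := ρ p) fun w u ↦ ?_⟩
    · rw [← lieDerivMetric_complete_complete_complete g₁ g₂ v w u p,
        h _ _ (isSmoothField_completeLift w) (isSmoothField_completeLift u),
        liftedMetric_complete_complete]
    · rw [← lieDerivMetric_complete_vertical_vertical g₁ g₂ v w u p,
        h _ _ (isSmoothField_verticalLift w) (isSmoothField_verticalLift u),
        liftedMetric_vertical_vertical]
  · rw [mul_zero, zero_mul]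
    refine lieDerivMetric_eq_zero_of_lifts (isSmoothField_completeLift v) p (fun w u ↦ ?_)
      (fun w u ↦ ?_) (fun w u ↦ ?_) (fun w u ↦ ?_) hY hZ
    · rw [lieDerivMetric_complete_complete_complete, h₁, neg_zero]
    · exact lieDerivMetric_complete_complete_vertical g₁ g₂ v w u p
    · exact lieDerivMetric_complete_vertical_complete g₁ g₂ v w u p
    · rw [lieDerivMetric_complete_vertical_vertical, h₂, neg_zero]

/-- The only components of `L_{X^v} g̃` on the frame of lifts that may be nonzero are the mixed ones
`-g₂([X, Y], Z)`; positivity is used at `Z = [X, Y]`. -/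
lemma isKillingField_verticalLift_iff :
    IsKillingField (liftedMetric g₁ g₂) (verticalLift (mulInvariantVectorField v)) ↔
      ∀ w : GroupLieAlgebra I G, ⁅v, w⁆ = 0 := by
  refine ⟨fun ⟨_, h⟩ w ↦ ?_, fun h ↦ ⟨isSmoothField_verticalLift v, fun Y Z hY hZ p ↦ ?_⟩⟩
  · by_contra hne
    have h1 := h _ _ (isSmoothField_completeLift w) (isSmoothField_verticalLift ⁅v, w⁆)
      (⟨1, 0⟩ : TangentBundle I G)
    rw [lieDerivMetric_vertical_complete_vertical, neg_eq_zero] at h1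
    exact (g₂.pos 1 _ hne).ne' h1
  · refine lieDerivMetric_eq_zero_of_lifts (isSmoothField_verticalLift v) p (fun w u ↦ ?_)
      (fun w u ↦ ?_) (fun w u ↦ ?_) (fun w u ↦ ?_) hY hZ
    · exact lieDerivMetric_vertical_complete_complete g₁ g₂ v w u p
    · rw [lieDerivMetric_vertical_complete_vertical, h, map_zero, zero_apply, neg_zero]
    · rw [lieDerivMetric_vertical_vertical_complete, h, map_zero, neg_zero]
    · exact lieDerivMetric_vertical_vertical_vertical g₁ g₂ v w u p

end LiftedMetric

end TangentLift

theorem theorem2p8 {E : Type*} [NormedAddCommGroup E] [NormedSpace ℝ E] [FiniteDimensional ℝ E]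
    {H : Type*} [TopologicalSpace H] {I : ModelWithCorners ℝ E H} [I.Boundaryless]
    {G : Type*} [TopologicalSpace G] [ChartedSpace H G] [Group G] [LieGroup I ∞ G]
    (g₁ g₂ : TangentLift.SmoothMetric I G)
    (hg₁ : TangentLift.IsLeftInvariantMetric g₁) (hg₂ : TangentLift.IsLeftInvariantMetric g₂)
    (X : GroupLieAlgebra I G) :
    ((TangentLift.IsConformalField g₁ (mulInvariantVectorField X) ∧
        TangentLift.IsConformalField g₂ (mulInvariantVectorField X)) ↔
      TangentLift.IsConformalField (TangentLift.liftedMetric g₁ g₂)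
        (TangentLift.completeLift (mulInvariantVectorField X))) ∧
    (TangentLift.IsKillingField (TangentLift.liftedMetric g₁ g₂)
        (TangentLift.verticalLift (mulInvariantVectorField X)) ↔
      X ∈ LieAlgebra.center ℝ (GroupLieAlgebra I G)) := by
  refine ⟨?_, ?_⟩
  · rw [TangentLift.isConformalField_mulInvariantVectorField_iff hg₁,
      TangentLift.isConformalField_mulInvariantVectorField_iff hg₂,
      TangentLift.isConformalField_completeLift_iff]
  · rw [TangentLift.isKillingField_verticalLift_iff, LieModule.mem_maxTrivSubmodule]
    refine forall_congr' fun w ↦ ?_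
    rw [← lie_skew, neg_eq_zero]
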